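/- Let $\mathcal V$ be a symmetric monoidal category with symmetry $\sigma$ and unit $I$, and let $A$ be a bimonoid in $\mathcal V$ equipped with a braiding coelement, that is, a convolution-invertible morphism $\gamma:A\otimes A\to I$ such that, in element notation (which abbreviates composites of structure morphisms and symmetries in $\mathcal V$, with $a\mapsto a_1\otimes a_2$ the comultiplication), $$a_1b_1\,\gamma(b_2\otimes a_2)=\gamma(b_1\otimes a_1)\,b_2a_2,\qquad \gamma(a\otimes bc)=\gamma(a_1\otimes c)\,\gamma(a_2\otimes b),\qquad \gamma(ab\otimes c)=\gamma(a\otimes c_1)\,\gamma(b\otimes c_2).$$ Let $\mathcal W=\mathrm{Comod}_{\mathcal V}(A)$ be the category of left $A$-comodules $\alpha_X:X\to A\otimes X$, $x\mapsto x_{-1}\otimes x_0$ (iterated coactions are written $x\mapsto x_{-2}\otimes x_{-1}\otimes x_0$, etc.), made monoidal by the coaction $x\otimes y\mapsto x_{-1}y_{-1}\otimes x_0\otimes y_0$ on $X\otimes Y$ and the unit $\eta_A:I\to A$ as coaction on $I$, and braided by $x\otimes y\mapsto \gamma(y_{-1}\otimes x_{-1})\,y_0\otimes x_0$. Let $H$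 be a bimonoid in $\mathcal W$; its monoid and comonoid structures are also regarded as such structures in $\mathcal V$. Define morphisms of $\mathcal V$ $$\tau_H:H\otimes A\to A\otimes H,\quad h\otimes a\mapsto h_{-1}a\otimes h_0,\qquad\qquad s_{AH}:A\otimes H\to H\otimes A,\quad a\otimes h\mapsto\gamma(h_{-1}\otimes a_1)\,h_0\otimes a_2,$$ so that $s_{AH}$ is the braiding in $\mathcal W$ of $A$ (coacting on itself by its comultiplication) with $H$. Then: 1. $\tau_H$ is a distributive law between the comonoids $H$ and $A$ in $\mathcal V$ (it satisfies the two counit and two comultiplication axioms), and $s_{AH}$ is a distributive law between the monoids $A$ and $H$ in $\mathcal V$ (it satisfies the two unit and two multiplication axioms). 2. The semidirect product $H\rtimes A$, that is, the object $H\otimes A$ with the comonoid structure induced by $\tau_H$, $$\delta=(1_H\otimes\tau_H\otimes 1_A)(\delta_H\otimes\delta_A),\qquad \epsilon=\epsilon_H\otimes\epsilon_A,$$ and the monoid structure induced by $s_{AH}$, $$\mu=(\mu_H\otimes\mu_A)(1_H\otimes s_{AH}\otimes 1_A),\qquad \eta=\eta_H\otimes\eta_A,$$ is a bimonoid in $\mathcal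 V$. 3. If moreover $A$ is a Hopf monoid in $\mathcal V$ with antipode $S_A$ and $H$ is a Hopf monoid in $\mathcal W$ with antipode $S_H$, then $H\rtimes A$ is a Hopf monoid in $\mathcal V$ with antipode $$h\otimes a\;\longmapsto\;\gamma\bigl(h_{-1}\otimes S_A(h_{-2}a_2)\bigr)\,S_H(h_0)\otimes S_A(h_{-3}a_1).$$ -/

import Mathlib

open CategoryTheory MonoidalCategory
open scoped MonObj ComonObj HopfObj

universe v u

/-- A left comodule over a comonoid `A`. -/
structure LeftComod {V : Type u} [Category.{v} V] [MonoidalCategory V] (A : V) [ComonObj A] where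
  X : V
  coact : X ⟶ A ⊗ X
  coact_counit : coact ≫ ε[A] ▷ X = (λ_ X).inv
  coact_comul : coact ≫ Δ[A] ▷ X = coact ≫ A ◁ coact ≫ (α_ A A X).inv

namespace LeftComod

section Category

variable {V : Type u} [Category.{v} V] [MonoidalCategory V] {A : V} [ComonObj A]

theorem coact_counit_assoc (M : LeftComod A) {Z : V} (h : 𝟙_ V ⊗ M.X ⟶ Z) :
    M.coact ≫ ε[A] ▷ M.X ≫ h = (λ_ M.X).inv ≫ h := by
  rw [← Category.assoc, coact_counit]

theorem coact_comul_assoc (M : LeftComod A) {Z : V} (h : (A ⊗ A) ⊗ M.X ⟶ Z) :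
    M.coact ≫ Δ[A] ▷ M.X ≫ h = M.coact ≫ A ◁ M.coact ≫ (α_ A A M.X).inv ≫ h := by
  rw [← Category.assoc, coact_comul, Category.assoc, Category.assoc]

/-- A morphism of left comodules. -/
@[ext]
structure Hom (M N : LeftComod A) where
  hom : M.X ⟶ N.X
  comm : M.coact ≫ A ◁ hom = hom ≫ N.coact

attribute [simp] Hom.comm

@[simp] theorem Hom.comm_assoc {M N : LeftComod A} (f : Hom M N) {Z : V} (h : A ⊗ N.X ⟶ Z) :
    M.coact ≫ A ◁ f.hom ≫ h = f.hom ≫ N.coact ≫ h := by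
  rw [← Category.assoc, f.comm, Category.assoc]

/-- The category of left `A`-comodules. -/
instance : Category (LeftComod A) where
  Hom M N := Hom M N
  id M := { hom := 𝟙 M.X, comm := by simp }
  comp f g := { hom := f.hom ≫ g.hom, comm := by simp }

@[simp] theorem id_hom (M : LeftComod A) : Hom.hom (𝟙 M) = 𝟙 M.X := rfl

@[simp] theorem comp_hom {M N P : LeftComod A} (f : M ⟶ N) (g : N ⟶ P) :
    (f ≫ g).hom = f.hom ≫ g.hom := rfl

@[ext] theorem hom_ext {M N : LeftComod A} {f g : M ⟶ N} (h : f.hom = g.hom) : f = g :=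
  Hom.ext h

/-- An isomorphism of comodules from an isomorphism in `V` that commutes with the coactions. -/
@[simps]
def mkIso {M N : LeftComod A} (e : M.X ≅ N.X) (h : M.coact ≫ A ◁ e.hom = e.hom ≫ N.coact) :
    M ≅ N where
  hom := { hom := e.hom, comm := h }
  inv :=
    { hom := e.inv
      comm := by
        rw [Iso.eq_inv_comp, ← reassoc_of% h, ← MonoidalCategory.whiskerLeft_comp]
        simp }

variable (A) in
/-- The comonoid `A`, coacting on itself by its comultiplication. -/
@[simps]
def regular : LeftComod A where
  X := A
  coact := Δ[A]
  coact_counit := by simp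
  coact_comul := by simp

end Category

section Monoidal

variable {V : Type u} [Category.{v} V] [MonoidalCategory V] [BraidedCategory V]

theorem tensorμ_whiskerRight {A B A' B' : V} (f : A ⟶ B) (g : A' ⟶ B') (X Y : V) :
    (f ▷ X ⊗ₘ g ▷ Y) ≫ tensorμ B X B' Y = tensorμ A X A' Y ≫ (f ⊗ₘ g) ▷ (X ⊗ Y) := by
  simpa only [tensorHom_id, id_whiskerRight] using tensorμ_natural f (𝟙 X) g (𝟙 Y)

theorem tensorμ_whiskerRight_assoc {A B A' B' : V} (f : A ⟶ B) (g : A' ⟶ B') (X Y : V) {Z : V}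
    (h : (B ⊗ B') ⊗ (X ⊗ Y) ⟶ Z) :
    (f ▷ X ⊗ₘ g ▷ Y) ≫ tensorμ B X B' Y ≫ h =
      tensorμ A X A' Y ≫ (f ⊗ₘ g) ▷ (X ⊗ Y) ≫ h := by
  rw [← Category.assoc, tensorμ_whiskerRight, Category.assoc]

theorem tensorμ_whiskerLeft {X Y X' Y' : V} (A B : V) (f : X ⟶ X') (g : Y ⟶ Y') :
    (A ◁ f ⊗ₘ B ◁ g) ≫ tensorμ A X' B Y' = tensorμ A X B Y ≫ (A ⊗ B) ◁ (f ⊗ₘ g) := by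
  have h := tensorμ_natural (𝟙 A) f (𝟙 B) g
  rwa [id_tensorHom, id_tensorHom, id_tensorHom_id, id_tensorHom] at h

theorem tensorμ_whiskerLeft_assoc {X Y X' Y' : V} (A B : V) (f : X ⟶ X') (g : Y ⟶ Y') {Z : V}
    (h : (A ⊗ B) ⊗ (X' ⊗ Y') ⟶ Z) :
    (A ◁ f ⊗ₘ B ◁ g) ≫ tensorμ A X' B Y' ≫ h =
      tensorμ A X B Y ≫ (A ⊗ B) ◁ (f ⊗ₘ g) ≫ h := by
  rw [← Category.assoc, tensorμ_whiskerLeft, Category.assoc]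

theorem associator_inv_tensorμ (X₁ X₂ X₃ Y₁ Y₂ Y₃ : V) :
    ((α_ X₁ X₂ X₃).inv ⊗ₘ (α_ Y₁ Y₂ Y₃).inv) ≫ tensorμ (X₁ ⊗ X₂) X₃ (Y₁ ⊗ Y₂) Y₃ ≫
        (tensorμ X₁ X₂ Y₁ Y₂ ▷ (X₃ ⊗ Y₃)) =
      tensorμ X₁ (X₂ ⊗ X₃) Y₁ (Y₂ ⊗ Y₃) ≫ ((X₁ ⊗ Y₁) ◁ tensorμ X₂ X₃ Y₂ Y₃) ≫
        (α_ (X₁ ⊗ Y₁) (X₂ ⊗ Y₂) (X₃ ⊗ Y₃)).inv := by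
  have h := associator_monoidal X₁ X₂ X₃ Y₁ Y₂ Y₃
  rw [← cancel_epi ((α_ X₁ X₂ X₃).hom ⊗ₘ (α_ Y₁ Y₂ Y₃).hom), ← reassoc_of% h]
  simp

/-- The coaction of `C ⊗ D` on the tensor product of a `C`-comodule and a `D`-comodule. -/
def extCoact {C D : V} [ComonObj C] [ComonObj D] (M : LeftComod C) (N : LeftComod D) :
    M.X ⊗ N.X ⟶ (C ⊗ D) ⊗ (M.X ⊗ N.X) :=
  (M.coact ⊗ₘ N.coact) ≫ tensorμ C M.X D N.X

/-- The external tensor product of a `C`-comodule and a `D`-comodule, a `C ⊗ D`-comodule. -/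
@[reducible]
def ext {C D : V} [ComonObj C] [ComonObj D] (M : LeftComod C) (N : LeftComod D) :
    LeftComod (C ⊗ D) where
  X := M.X ⊗ N.X
  coact := extCoact M N
  coact_counit := by
    rw [extCoact]
    have h2 := leftUnitor_monoidal M.X N.X
    rw [Comon.tensorObj_counit, comp_whiskerRight, Category.assoc, ← tensorμ_whiskerRight_assoc,
      ← Category.assoc, tensorHom_comp_tensorHom, coact_counit, coact_counit,
      ← cancel_mono (λ_ (M.X ⊗ N.X)).hom]
    simp only [Category.assoc, ← h2]
    simp
  coact_comul := by
    rw [extCoact]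
    rw [Comon.tensorObj_comul]
    simp only [comp_whiskerRight, MonoidalCategory.whiskerLeft_comp, Category.assoc]
    rw [← tensorμ_whiskerRight_assoc, ← Category.assoc (M.coact ⊗ₘ N.coact),
      tensorHom_comp_tensorHom, coact_comul, coact_comul, ← tensorHom_comp_tensorHom,
      ← tensorHom_comp_tensorHom, Category.assoc, Category.assoc, associator_inv_tensorμ,
      tensorμ_whiskerLeft_assoc]

variable {A : V} [BimonObj A]

/-- The coaction `x ⊗ y ↦ x₍₋₁₎y₍₋₁₎ ⊗ x₍₀₎ ⊗ y₍₀₎` on a tensor product. -/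
def tensorCoact (M N : LeftComod A) : M.X ⊗ N.X ⟶ A ⊗ (M.X ⊗ N.X) :=
  (M.coact ⊗ₘ N.coact) ≫ tensorμ A M.X A N.X ≫ μ[A] ▷ (M.X ⊗ N.X)

theorem tensorCoact_eq (M N : LeftComod A) :
    tensorCoact M N = extCoact M N ≫ μ[A] ▷ (M.X ⊗ N.X) := by
  rw [tensorCoact, extCoact, Category.assoc]

theorem tensorCoact_counit (M N : LeftComod A) :
    tensorCoact M N ≫ ε[A] ▷ (M.X ⊗ N.X) = (λ_ (M.X ⊗ N.X)).inv := by
  rw [tensorCoact_eq, Category.assoc, ← comp_whiskerRight, BimonObj.mul_counit]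
  exact (ext M N).coact_counit

theorem tensorCoact_comul (M N : LeftComod A) :
    tensorCoact M N ≫ Δ[A] ▷ (M.X ⊗ N.X) =
      tensorCoact M N ≫ A ◁ tensorCoact M N ≫ (α_ A A (M.X ⊗ N.X)).inv := by
  have h := (ext M N).coact_comul
  rw [Comon.tensorObj_comul] at h
  have h' : extCoact M N ≫ ((Δ[A] ⊗ₘ Δ[A]) ≫ tensorμ A A A A) ▷ (M.X ⊗ N.X) =
    extCoact M N ≫ (A ⊗ A) ◁ extCoact M N ≫ (α_ (A ⊗ A) (A ⊗ A) (M.X ⊗ N.X)).inv := h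
  rw [tensorCoact_eq, Category.assoc, ← comp_whiskerRight, BimonObj.mul_comul, ← Category.assoc,
    comp_whiskerRight, reassoc_of% h']
  simp only [MonoidalCategory.whiskerLeft_comp, Category.assoc]
  rw [← whisker_exchange_assoc, MonoidalCategory.tensorHom_def μ[A] μ[A]]
  monoidal

theorem tensorCoact_natural {M M' N N' : LeftComod A} (f : M ⟶ M') (g : N ⟶ N') :
    tensorCoact M N ≫ A ◁ (f.hom ⊗ₘ g.hom) = (f.hom ⊗ₘ g.hom) ≫ tensorCoact M' N' := by
  simp only [tensorCoact, Category.assoc, ← whisker_exchange]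
  rw [← tensorμ_whiskerLeft_assoc, ← Category.assoc, tensorHom_comp_tensorHom, Hom.comm, Hom.comm,
    ← tensorHom_comp_tensorHom, Category.assoc]

/-- The tensor product of comodules. -/
@[reducible]
def tensor (M N : LeftComod A) : LeftComod A where
  X := M.X ⊗ N.X
  coact := tensorCoact M N
  coact_counit := tensorCoact_counit M N
  coact_comul := tensorCoact_comul M N

/-- The unit comodule, with coaction the unit of `A`. -/
@[reducible]
def unit (A : V) [BimonObj A] : LeftComod A where
  X := 𝟙_ V
  coact := η[A] ≫ (ρ_ A).inv
  coact_counit := by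
    rw [Category.assoc, ← rightUnitor_inv_naturality, BimonObj.one_counit_assoc, unitors_inv_equal]
  coact_comul := by
    rw [Category.assoc, ← rightUnitor_inv_naturality, BimonObj.one_comul_assoc,
      MonObj.tensorObj.one_def, MonoidalCategory.tensorHom_def]
    monoidal

theorem tensorCoact_associator (M N P : LeftComod A) :
    tensorCoact (tensor M N) P ≫ A ◁ (α_ M.X N.X P.X).hom =
      (α_ M.X N.X P.X).hom ≫ tensorCoact M (tensor N P) := by
  have h := tensorμ_whiskerRight μ[A] (𝟙 A) (M.X ⊗ N.X) P.X
  have h' := tensorμ_whiskerRight (𝟙 A) μ[A] M.X (N.X ⊗ P.X)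
  have h2 := tensor_associativity A M.X A N.X A P.X
  rw [id_whiskerRight] at h h'
  have e1 : ((M.coact ⊗ₘ N.coact) ≫ tensorμ A M.X A N.X ≫ μ[A] ▷ (M.X ⊗ N.X)) ⊗ₘ P.coact =
      ((M.coact ⊗ₘ N.coact) ⊗ₘ P.coact) ≫ tensorμ A M.X A N.X ▷ (A ⊗ P.X) ≫
        (μ[A] ▷ (M.X ⊗ N.X) ⊗ₘ 𝟙 (A ⊗ P.X)) := by
    simp only [MonoidalCategory.tensorHom_def, comp_whiskerRight, Category.assoc,
      ← whisker_exchange, ← whisker_exchange_assoc, whiskerLeft_id, Category.comp_id]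
  have e2 : M.coact ⊗ₘ ((N.coact ⊗ₘ P.coact) ≫ tensorμ A N.X A P.X ≫ μ[A] ▷ (N.X ⊗ P.X)) =
      (M.coact ⊗ₘ (N.coact ⊗ₘ P.coact)) ≫ (A ⊗ M.X) ◁ tensorμ A N.X A P.X ≫
        (𝟙 (A ⊗ M.X) ⊗ₘ μ[A] ▷ (N.X ⊗ P.X)) := by
    simp only [MonoidalCategory.tensorHom_def, MonoidalCategory.whiskerLeft_comp,
      Category.assoc, id_whiskerRight, Category.id_comp]
  simp only [tensorCoact]
  rw [e1, e2]
  simp only [Category.assoc]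
  rw [reassoc_of% h, reassoc_of% h', ← associator_naturality_assoc, ← reassoc_of% h2]
  rw [tensorHom_id, id_tensorHom, MonoidalCategory.tensorHom_def' (α_ A A A).hom, Category.assoc,
    ← comp_whiskerRight, ← comp_whiskerRight, ← MonObj.mul_assoc, whisker_exchange,
    comp_whiskerRight_assoc]

theorem tensorCoact_leftUnitor (M : LeftComod A) :
    tensorCoact (unit A) M ≫ A ◁ (λ_ M.X).hom = (λ_ M.X).hom ≫ M.coact := by
  have h2 := tensor_left_unitality A M.X
  have h := tensorμ_whiskerRight η[A] (𝟙 A) (𝟙_ V) M.X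
  have e : (η[A] ≫ (ρ_ A).inv) ⊗ₘ M.coact =
     (𝟙_ V ◁ M.coact) ≫ ((λ_ (𝟙_ V)).inv ▷ (A ⊗ M.X)) ≫ (η[A] ▷ 𝟙_ V ⊗ₘ 𝟙 A ▷ M.X) := by
    rw [rightUnitor_inv_naturality, unitors_inv_equal]
    simp [MonoidalCategory.tensorHom_def']
  simp only [tensorCoact]
  rw [e]
  simp only [Category.assoc]
  rw [reassoc_of% h, ← leftUnitor_naturality, h2]
  rw [tensorHom_id, ← comp_whiskerRight_assoc, MonObj.one_mul, MonoidalCategory.tensorHom_def]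

theorem tensorCoact_rightUnitor (M : LeftComod A) :
    tensorCoact M (unit A) ≫ A ◁ (ρ_ M.X).hom = (ρ_ M.X).hom ≫ M.coact := by
  have h2 := tensor_right_unitality A M.X
  have h := tensorμ_whiskerRight (𝟙 A) η[A] M.X (𝟙_ V)
  have e : M.coact ⊗ₘ (η[A] ≫ (ρ_ A).inv) =
     (M.coact ▷ 𝟙_ V) ≫ ((A ⊗ M.X) ◁ (λ_ (𝟙_ V)).inv) ≫ (𝟙 A ▷ M.X ⊗ₘ η[A] ▷ 𝟙_ V) := by
    rw [rightUnitor_inv_naturality, unitors_inv_equal]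
    simp [MonoidalCategory.tensorHom_def]
  simp only [tensorCoact]
  rw [e]
  simp only [Category.assoc]
  rw [reassoc_of% h, ← rightUnitor_naturality, h2]
  rw [id_tensorHom, ← comp_whiskerRight_assoc, MonObj.mul_one, MonoidalCategory.tensorHom_def]

@[simps tensorObj tensorUnit]
instance : MonoidalCategoryStruct (LeftComod A) where
  tensorObj M N := tensor M N
  tensorUnit := unit A
  whiskerLeft M _ _ f :=
    { hom := M.X ◁ f.hom
      comm := by simpa using tensorCoact_natural (𝟙 M) f }
  whiskerRight f M :=
    { hom := f.hom ▷ M.X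
      comm := by simpa using tensorCoact_natural f (𝟙 M) }
  tensorHom f g :=
    { hom := f.hom ⊗ₘ g.hom
      comm := tensorCoact_natural f g }
  associator M N P := mkIso (α_ M.X N.X P.X) (tensorCoact_associator M N P)
  leftUnitor M := mkIso (λ_ M.X) (tensorCoact_leftUnitor M)
  rightUnitor M := mkIso (ρ_ M.X) (tensorCoact_rightUnitor M)

@[simp] theorem tensorObj_X (M N : LeftComod A) : (M ⊗ N).X = M.X ⊗ N.X := rfl

@[simp] theorem tensorUnit_X : (𝟙_ (LeftComod A)).X = 𝟙_ V := rfl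

theorem tensorObj_coact (M N : LeftComod A) : (M ⊗ N).coact =
    (M.coact ⊗ₘ N.coact) ≫ tensorμ A M.X A N.X ≫ μ[A] ▷ (M.X ⊗ N.X) := rfl

theorem tensorUnit_coact : (𝟙_ (LeftComod A)).coact = η[A] ≫ (ρ_ A).inv := rfl

@[simp] theorem tensorHom_hom {M M' N N' : LeftComod A} (f : M ⟶ M') (g : N ⟶ N') :
    (f ⊗ₘ g).hom = f.hom ⊗ₘ g.hom := rfl

@[simp] theorem whiskerLeft_hom (M : LeftComod A) {N N' : LeftComod A} (f : N ⟶ N') :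
    (M ◁ f).hom = M.X ◁ f.hom := rfl

@[simp] theorem whiskerRight_hom {N N' : LeftComod A} (f : N ⟶ N') (M : LeftComod A) :
    (f ▷ M).hom = f.hom ▷ M.X := rfl

@[simp] theorem associator_hom_hom (M N P : LeftComod A) :
    (α_ M N P).hom.hom = (α_ M.X N.X P.X).hom := rfl

@[simp] theorem associator_inv_hom (M N P : LeftComod A) :
    (α_ M N P).inv.hom = (α_ M.X N.X P.X).inv := rfl

@[simp] theorem leftUnitor_hom_hom (M : LeftComod A) : (λ_ M).hom.hom = (λ_ M.X).hom := rfl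

@[simp] theorem leftUnitor_inv_hom (M : LeftComod A) : (λ_ M).inv.hom = (λ_ M.X).inv := rfl

@[simp] theorem rightUnitor_hom_hom (M : LeftComod A) : (ρ_ M).hom.hom = (ρ_ M.X).hom := rfl

@[simp] theorem rightUnitor_inv_hom (M : LeftComod A) : (ρ_ M).inv.hom = (ρ_ M.X).inv := rfl

/-- Comodules over a bimonoid form a monoidal category; the forgetful functor to `V` is strict
monoidal. -/
instance : MonoidalCategory (LeftComod A) where
  tensorHom_def f g := hom_ext (MonoidalCategory.tensorHom_def f.hom g.hom)
  id_tensorHom_id M N := hom_ext (id_tensorHom_id M.X N.X)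
  tensorHom_comp_tensorHom f g h k :=
    hom_ext (tensorHom_comp_tensorHom f.hom g.hom h.hom k.hom)
  whiskerLeft_id M N := hom_ext (whiskerLeft_id M.X N.X)
  id_whiskerRight M N := hom_ext (id_whiskerRight M.X N.X)
  associator_naturality f g h := hom_ext (associator_naturality f.hom g.hom h.hom)
  leftUnitor_naturality f := hom_ext (leftUnitor_naturality f.hom)
  rightUnitor_naturality f := hom_ext (rightUnitor_naturality f.hom)
  pentagon M N P Q := hom_ext (pentagon M.X N.X P.X Q.X)
  triangle M N := hom_ext (triangle M.X N.X)

end Monoidal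

section Act

variable {V : Type u} [Category.{v} V] [MonoidalCategory V]

/-- The endomorphism `x ↦ f(x₍₋₁₎) x₍₀₎` given by a functional `f` on the comonoid. -/
def act {C : V} [ComonObj C] (M : LeftComod C) (f : C ⟶ 𝟙_ V) : M.X ⟶ M.X :=
  M.coact ≫ f ▷ M.X ≫ (λ_ M.X).hom

theorem act_counit {C : V} [ComonObj C] (M : LeftComod C) : act M ε[C] = 𝟙 M.X := by
  rw [act, coact_counit_assoc, Iso.inv_hom_id]

/-- Applying `f` and then coacting. -/
theorem act_comp_coact {C : V} [ComonObj C] (M : LeftComod C) (f : C ⟶ 𝟙_ V) {B : V} (g : C ⟶ B) :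
    act M f ≫ M.coact ≫ g ▷ M.X = M.coact ≫ (Δ[C] ≫ (f ⊗ₘ g) ≫ (λ_ B).hom) ▷ M.X := by
  simp only [act, comp_whiskerRight, Category.assoc, coact_comul_assoc,
    MonoidalCategory.tensorHom_def']
  rw [← leftUnitor_naturality_assoc, ← whisker_exchange_assoc]
  have h := whisker_exchange f g
  have h' := congrArg (fun t => t ▷ M.X) h
  simp only [comp_whiskerRight] at h'
  rw [reassoc_of% h']
  monoidal

theorem coact_act {C : V} [ComonObj C] (M : LeftComod C) (f : C ⟶ 𝟙_ V) {B : V} (g : C ⟶ B) :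
    M.coact ≫ g ▷ M.X ≫ B ◁ act M f = M.coact ≫ (Δ[C] ≫ (g ⊗ₘ f) ≫ (ρ_ B).hom) ▷ M.X := by
  simp only [act, comp_whiskerRight, Category.assoc, coact_comul_assoc,
    MonoidalCategory.tensorHom_def, MonoidalCategory.whiskerLeft_comp]
  rw [← whisker_exchange_assoc]
  monoidal

theorem act_comp {C : V} [ComonObj C] (M : LeftComod C) (f g : C ⟶ 𝟙_ V) :
    act M f ≫ act M g = act M (Δ[C] ≫ (f ⊗ₘ g) ≫ (λ_ (𝟙_ V)).hom) := by
  have h := act_comp_coact M f g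
  have h' : act M f ≫ M.coact ≫ g ▷ M.X ≫ (λ_ M.X).hom =
      M.coact ≫ (Δ[C] ≫ (f ⊗ₘ g) ≫ (λ_ (𝟙_ V)).hom) ▷ M.X ≫ (λ_ M.X).hom := by
    rw [reassoc_of% h]
  exact h'

/-- Transport of functionals along a morphism compatible with coactions. -/
theorem act_transport {C D : V} [ComonObj C] [ComonObj D] (M : LeftComod C) (N : LeftComod D)
    (p : C ⟶ D) (q : M.X ⟶ N.X) (h : M.coact ≫ (p ⊗ₘ q) = q ≫ N.coact) (f : D ⟶ 𝟙_ V) :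
    q ≫ act N f = act M (p ≫ f) ≫ q := by
  rw [act, act, ← reassoc_of% h, MonoidalCategory.tensorHom_def, comp_whiskerRight]
  simp only [Category.assoc]
  rw [whisker_exchange_assoc, leftUnitor_naturality]

variable [BraidedCategory V]

theorem act_ext {C D : V} [ComonObj C] [ComonObj D] (M : LeftComod C) (N : LeftComod D)
    (f : C ⟶ 𝟙_ V) (g : D ⟶ 𝟙_ V) :
    act (ext M N) ((f ⊗ₘ g) ≫ (λ_ (𝟙_ V)).hom) = act M f ⊗ₘ act N g := by
  have h := leftUnitor_monoidal M.X N.X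
  simp only [act, extCoact, comp_whiskerRight, Category.assoc]
  rw [← tensorμ_whiskerRight_assoc, ← h]
  simp only [tensorHom_comp_tensorHom]

end Act

section Braiding

variable {V : Type u} [Category.{v} V] [MonoidalCategory V] [SymmetricCategory V]

theorem tensorμ_swap (X₁ X₂ Y₁ Y₂ : V) :
    tensorμ X₁ X₂ Y₁ Y₂ ≫ ((β_ X₁ Y₁).hom ⊗ₘ (β_ X₂ Y₂).hom) =
      (β_ (X₁ ⊗ X₂) (Y₁ ⊗ Y₂)).hom ≫ tensorμ Y₁ Y₂ X₁ X₂ := by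
  simp [tensorμ, SymmetricCategory.braiding_swap_eq_inv_braiding Y₂ X₁,
    MonoidalCategory.tensorHom_def]

theorem ext_swap {C D : V} [ComonObj C] [ComonObj D] (M : LeftComod C) (N : LeftComod D) :
    extCoact M N ≫ ((β_ C D).hom ⊗ₘ (β_ M.X N.X).hom) =
      (β_ M.X N.X).hom ≫ extCoact N M := by
  rw [extCoact, extCoact, Category.assoc, tensorμ_swap, BraidedCategory.braiding_naturality_assoc]

theorem ext_assoc {C D E : V} [ComonObj C] [ComonObj D] [ComonObj E]
    (M : LeftComod C) (N : LeftComod D) (P : LeftComod E) :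
    extCoact (ext M N) P ≫ ((α_ C D E).hom ⊗ₘ (α_ M.X N.X P.X).hom) =
      (α_ M.X N.X P.X).hom ≫ extCoact M (ext N P) := by
  have h2 := tensor_associativity C M.X D N.X E P.X
  have e1 : ((M.coact ⊗ₘ N.coact) ≫ tensorμ C M.X D N.X) ⊗ₘ P.coact =
      ((M.coact ⊗ₘ N.coact) ⊗ₘ P.coact) ≫ tensorμ C M.X D N.X ▷ (E ⊗ P.X) := by
    simp only [MonoidalCategory.tensorHom_def, comp_whiskerRight, Category.assoc,
      whisker_exchange]
  have e2 : M.coact ⊗ₘ ((N.coact ⊗ₘ P.coact) ≫ tensorμ D N.X E P.X) =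
      (M.coact ⊗ₘ (N.coact ⊗ₘ P.coact)) ≫ (C ⊗ M.X) ◁ tensorμ D N.X E P.X := by
    simp only [MonoidalCategory.tensorHom_def, MonoidalCategory.whiskerLeft_comp,
      Category.assoc]
  simp only [extCoact, Category.assoc]
  rw [e1, e2, Category.assoc, Category.assoc, h2, associator_naturality_assoc]

theorem ext_tensor {A : V} [BimonObj A] (M N : LeftComod A) :
    (ext M N).coact ≫ (μ[A] ⊗ₘ 𝟙 (ext M N).X) = 𝟙 (ext M N).X ≫ (tensor M N).coact := by
  rw [tensorHom_id, Category.id_comp]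
  exact (tensorCoact_eq M N).symm

/-- A braiding coelement on a bimonoid `A`: a convolution-invertible morphism `coelt : A ⊗ A ⟶ 𝟙_ V`
such that, writing `γ` for `coelt` and using element notation,
* `a₁ b₁ γ(b₂ ⊗ a₂) = γ(b₁ ⊗ a₁) b₂ a₂`,
* `γ(a ⊗ b c) = γ(a₁ ⊗ c) γ(a₂ ⊗ b)`,
* `γ(a b ⊗ c) = γ(a ⊗ c₁) γ(b ⊗ c₂)`. -/
class _root_.BraidingCoelement (A : V) [BimonObj A] where
  coelt : A ⊗ A ⟶ 𝟙_ V
  coeltInv : A ⊗ A ⟶ 𝟙_ V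
  coelt_conv_inv : Δ[A ⊗ A] ≫ (coelt ⊗ₘ coeltInv) ≫ (λ_ (𝟙_ V)).hom = ε[A ⊗ A]
  coelt_inv_conv : Δ[A ⊗ A] ≫ (coeltInv ⊗ₘ coelt) ≫ (λ_ (𝟙_ V)).hom = ε[A ⊗ A]
  mul_conv_coelt :
    (Δ[A] ⊗ₘ Δ[A]) ≫ tensorμ A A A A ≫ (μ[A] ⊗ₘ ((β_ A A).hom ≫ coelt)) ≫ (ρ_ A).hom =
      (β_ A A).hom ≫ (Δ[A] ⊗ₘ Δ[A]) ≫ tensorμ A A A A ≫ (coelt ⊗ₘ μ[A]) ≫ (λ_ A).hom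
  coelt_mul_right :
    A ◁ μ[A] ≫ coelt =
      (Δ[A] ⊗ₘ (β_ A A).hom) ≫ tensorμ A A A A ≫ (coelt ⊗ₘ coelt) ≫ (λ_ (𝟙_ V)).hom
  coelt_mul_left :
    μ[A] ▷ A ≫ coelt = (A ⊗ A) ◁ Δ[A] ≫ tensorμ A A A A ≫ (coelt ⊗ₘ coelt) ≫ (λ_ (𝟙_ V)).hom

open BraidingCoelement

variable {A : V} [BimonObj A] [BraidingCoelement A]

/-- The braiding `x ⊗ y ↦ γ(y₍₋₁₎ ⊗ x₍₋₁₎) y₍₀₎ ⊗ x₍₀₎` on the underlying objects. -/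
def braid (M N : LeftComod A) : M.X ⊗ N.X ⟶ N.X ⊗ M.X :=
  (β_ M.X N.X).hom ≫ (N.coact ⊗ₘ M.coact) ≫ tensorμ A N.X A M.X ≫ coelt ▷ (N.X ⊗ M.X) ≫
    (λ_ (N.X ⊗ M.X)).hom

theorem braid_eq (M N : LeftComod A) :
    braid M N = (β_ M.X N.X).hom ≫ act (ext N M) coelt := by
  simp [braid, act, extCoact]

/-- The braiding on underlying objects, as an isomorphism. -/
def braidIso (M N : LeftComod A) : M.X ⊗ N.X ≅ N.X ⊗ M.X where
  hom := braid M N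
  inv := act (ext N M) coeltInv ≫ (β_ M.X N.X).inv
  hom_inv_id := by
    have h := act_comp (ext N M) coelt coeltInv
    rw [coelt_conv_inv, act_counit] at h
    rw [braid_eq, Category.assoc, reassoc_of% h]
    simp
  inv_hom_id := by
    have h := act_comp (ext N M) coeltInv coelt
    rw [coelt_inv_conv, act_counit] at h
    rw [braid_eq, Category.assoc, Iso.inv_hom_id_assoc, h]

theorem braid_comm (M N : LeftComod A) :
    tensorCoact M N ≫ A ◁ braid M N = braid M N ≫ tensorCoact N M := by
  have h1 := act_transport (ext M N) (ext N M) _ _ (ext_swap M N) coelt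
  have h2 : extCoact M N ≫ μ[A] ▷ (M.X ⊗ N.X) ≫ A ◁ act (ext M N) ((β_ A A).hom ≫ coelt) =
      extCoact M N ≫ (_ : _ ⟶ A) ▷ (M.X ⊗ N.X) :=
    coact_act (ext M N) ((β_ A A).hom ≫ coelt) μ[A]
  have h3 : act (ext N M) coelt ≫ extCoact N M ≫ μ[A] ▷ (N.X ⊗ M.X) =
      extCoact N M ≫ (_ : _ ⟶ A) ▷ (N.X ⊗ M.X) := act_comp_coact (ext N M) coelt μ[A]
  have h4 := mul_conv_coelt (A := A)
  rw [Comon.tensorObj_comul, Category.assoc] at h2 h3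
  rw [braid_eq, h1, tensorCoact_eq, tensorCoact_eq, Category.assoc,
    MonoidalCategory.whiskerLeft_comp, reassoc_of% h2, h4, ← h1, Category.assoc, h3,
    ← reassoc_of% ext_swap M N, MonoidalCategory.tensorHom_def (β_ A A).hom, comp_whiskerRight, Category.assoc,
    Category.assoc, whisker_exchange]

theorem braid_natural {M M' N N' : LeftComod A} (f : M ⟶ M') (g : N ⟶ N') :
    (f.hom ⊗ₘ g.hom) ≫ braid M' N' = braid M N ≫ (g.hom ⊗ₘ f.hom) := by
  have h := act_transport (ext N M) (ext N' M') (𝟙 _) (g.hom ⊗ₘ f.hom) (by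
    simp only [id_tensorHom, extCoact, Category.assoc]
    rw [← tensorμ_whiskerLeft, ← Category.assoc, tensorHom_comp_tensorHom, Hom.comm, Hom.comm,
      ← tensorHom_comp_tensorHom, Category.assoc]) coelt
  rw [braid_eq, braid_eq, BraidedCategory.braiding_naturality_assoc, Category.assoc, h,
    Category.id_comp]

/-- `a ⊗ b ↦ a ε(b)`. -/
abbrev fstC (C D : V) [ComonObj D] : C ⊗ D ⟶ C := C ◁ ε[D] ≫ (ρ_ C).hom

/-- `a ⊗ b ↦ ε(a) b`. -/
abbrev sndC (C D : V) [ComonObj C] : C ⊗ D ⟶ D := ε[C] ▷ D ≫ (λ_ D).hom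

theorem comul_fst_snd (C D : V) [ComonObj C] [ComonObj D] :
    Δ[C ⊗ D] ≫ (fstC C D ⊗ₘ sndC C D) = 𝟙 (C ⊗ D) := by
  have h := tensorμ_natural (𝟙 C) ε[C] ε[D] (𝟙 D)
  have h2 : tensorμ C (𝟙_ V) (𝟙_ V) D ≫ ((ρ_ C).hom ⊗ₘ (λ_ D).hom) =
      (ρ_ C).hom ⊗ₘ (λ_ D).hom := by
    rw [tensorμ, braiding_tensorUnit_left]
    monoidal
  rw [Comon.tensorObj_comul, fstC, sndC, ← tensorHom_comp_tensorHom, Category.assoc,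
    ← id_tensorHom, ← tensorHom_id, ← reassoc_of% h, h2, tensorHom_comp_tensorHom_assoc,
    tensorHom_comp_tensorHom, id_tensorHom, tensorHom_id, ComonObj.comul_counit,
    ComonObj.counit_comul]
  simp

theorem comul_snd_fst (C D : V) [ComonObj C] [ComonObj D] :
    Δ[C ⊗ D] ≫ (sndC C D ⊗ₘ fstC C D) = (β_ C D).hom := by
  have h := tensorμ_natural ε[C] (𝟙 C) (𝟙 D) ε[D]
  have h2 : tensorμ (𝟙_ V) C D (𝟙_ V) ≫ ((λ_ D).hom ⊗ₘ (ρ_ C).hom) =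
      ((λ_ C).hom ⊗ₘ (ρ_ D).hom) ≫ (β_ C D).hom := by
    rw [tensorμ]
    monoidal
  rw [Comon.tensorObj_comul, fstC, sndC, ← tensorHom_comp_tensorHom, Category.assoc,
    ← id_tensorHom, ← tensorHom_id, ← reassoc_of% h, h2, tensorHom_comp_tensorHom_assoc,
    tensorHom_comp_tensorHom_assoc, id_tensorHom, tensorHom_id, ComonObj.comul_counit,
    ComonObj.counit_comul]
  simp

theorem comul_whiskerRight {C D E E' F F' : V} [ComonObj C] [ComonObj D] (f : C ⟶ E)
    (f' : C ⟶ E') (g : E ⊗ D ⟶ F) (g' : E' ⊗ D ⟶ F') :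
    Δ[C ⊗ D] ≫ (f ▷ D ≫ g ⊗ₘ f' ▷ D ≫ g') =
      (Δ[C] ≫ (f ⊗ₘ f')) ▷ D ≫ (E ⊗ E') ◁ Δ[D] ≫ tensorμ E E' D D ≫ (g ⊗ₘ g') := by
  have h := tensorμ_natural f f' (𝟙 D) (𝟙 D)
  rw [Comon.tensorObj_comul, ← tensorHom_comp_tensorHom, ← tensorHom_id, ← tensorHom_id,
    Category.assoc, ← reassoc_of% h, tensorHom_comp_tensorHom_assoc,
    ← MonoidalCategory.tensorHom_def_assoc]
  simp

theorem comul_whiskerLeft {C D E E' F F' : V} [ComonObj C] [ComonObj D] (f : D ⟶ E)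
    (f' : D ⟶ E') (g : C ⊗ E ⟶ F) (g' : C ⊗ E' ⟶ F') :
    Δ[C ⊗ D] ≫ (C ◁ f ≫ g ⊗ₘ C ◁ f' ≫ g') =
      (Δ[C] ⊗ₘ (Δ[D] ≫ (f ⊗ₘ f'))) ≫ tensorμ C C E E' ≫ (g ⊗ₘ g') := by
  have h := tensorμ_natural (𝟙 C) (𝟙 C) f f'
  rw [Comon.tensorObj_comul, ← tensorHom_comp_tensorHom, ← id_tensorHom, ← id_tensorHom,
    Category.assoc, ← reassoc_of% h, tensorHom_comp_tensorHom_assoc]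
  simp

theorem ext_whiskerLeft {C D D' : V} [ComonObj C] [ComonObj D] [ComonObj D'] (N : LeftComod C)
    {Q : LeftComod D} {Q' : LeftComod D'} (p : D ⟶ D') (q : Q.X ⟶ Q'.X)
    (h : Q.coact ≫ (p ⊗ₘ q) = q ≫ Q'.coact) :
    extCoact N Q ≫ (C ◁ p ⊗ₘ N.X ◁ q) = N.X ◁ q ≫ extCoact N Q' := by
  have h2 := tensorμ_natural (𝟙 C) (𝟙 N.X) p q
  rw [extCoact, extCoact, Category.assoc, ← id_tensorHom, ← id_tensorHom, ← h2,
    tensorHom_comp_tensorHom_assoc, tensorHom_comp_tensorHom_assoc, h]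
  simp

theorem ext_whiskerRight {C D D' : V} [ComonObj C] [ComonObj D] [ComonObj D'] (N : LeftComod C)
    {Q : LeftComod D} {Q' : LeftComod D'} (p : D ⟶ D') (q : Q.X ⟶ Q'.X)
    (h : Q.coact ≫ (p ⊗ₘ q) = q ≫ Q'.coact) :
    extCoact Q N ≫ (p ▷ C ⊗ₘ q ▷ N.X) = q ▷ N.X ≫ extCoact Q' N := by
  have h2 := tensorμ_natural p q (𝟙 C) (𝟙 N.X)
  rw [extCoact, extCoact, Category.assoc, ← tensorHom_id, ← tensorHom_id, ← h2,
    tensorHom_comp_tensorHom_assoc, tensorHom_comp_tensorHom_assoc, h]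
  simp

theorem hexagon_forward (M N P : LeftComod A) :
    (α_ M.X N.X P.X).hom ≫ braid M (tensor N P) ≫ (α_ N.X P.X M.X).hom =
      braid M N ▷ P.X ≫ (α_ N.X M.X P.X).hom ≫ N.X ◁ braid M P := by
  have key : act (ext (tensor N P) M) coelt =
      act (ext (ext N P) M) (μ[A] ▷ A ≫ coelt) := by
    have h := act_transport (ext (ext N P) M) (ext (tensor N P) M) _ _
      (ext_whiskerRight M μ[A] (𝟙 _) (ext_tensor N P)) coelt
    simpa using h
  have k2 : act (ext (ext N P) M) (μ[A] ▷ A ≫ coelt) =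
      act (ext (ext N P) M) (fstC A A ▷ A ≫ coelt) ≫
        act (ext (ext N P) M) (sndC A A ▷ A ≫ coelt) := by
    rw [act_comp, ← Category.assoc Δ[(A ⊗ A) ⊗ A], comul_whiskerRight, comul_fst_snd,
      coelt_mul_left]
    simp
  have k3 : act (ext (ext N P) M) (fstC A A ▷ A ≫ coelt) =
      (α_ N.X P.X M.X).hom ≫ N.X ◁ (β_ P.X M.X).hom ≫ (α_ N.X M.X P.X).inv ≫
       act (ext N M) coelt ▷ P.X ≫
      (α_ N.X M.X P.X).hom ≫ N.X ◁ (β_ M.X P.X).hom ≫ (α_ N.X P.X M.X).inv := by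
    have e := act_ext (ext N M) P coelt ε[A]
    rw [act_counit, tensorHom_id] at e
    have t1 := act_transport (ext (ext N M) P) (ext N (ext M P)) _ _ (ext_assoc N M P)
      ((α_ A A A).inv ≫ (coelt ⊗ₘ ε[A]) ≫ (λ_ (𝟙_ V)).hom)
    rw [Iso.hom_inv_id_assoc, e] at t1
    have t2 := act_transport (ext N (ext P M)) (ext N (ext M P)) _ _
      (ext_whiskerLeft N (Q := ext P M) (Q' := ext M P) _ _ (ext_swap P M))
      ((α_ A A A).inv ≫ (coelt ⊗ₘ ε[A]) ≫ (λ_ (𝟙_ V)).hom)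
    have t3 := act_transport (ext (ext N P) M) (ext N (ext P M)) _ _ (ext_assoc N P M)
      (A ◁ (β_ A A).hom ≫ (α_ A A A).inv ≫ (coelt ⊗ₘ ε[A]) ≫ (λ_ (𝟙_ V)).hom)
    have f : fstC A A ▷ A ≫ coelt = (α_ A A A).hom ≫ A ◁ (β_ A A).hom ≫ (α_ A A A).inv ≫
        (coelt ⊗ₘ ε[A]) ≫ (λ_ (𝟙_ V)).hom := by
      have b : ε[A] ▷ A ≫ (λ_ A).hom = (β_ A A).hom ≫ A ◁ ε[A] ≫ (ρ_ A).hom := by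
        rw [← BraidedCategory.braiding_naturality_left_assoc, braiding_rightUnitor]
      have c : fstC A A ▷ A = (α_ A A A).hom ≫ A ◁ (ε[A] ▷ A ≫ (λ_ A).hom) := by
        rw [fstC]; monoidal
      have u : (coelt ⊗ₘ ε[A]) ≫ (λ_ (𝟙_ V)).hom =
          (A ⊗ A) ◁ ε[A] ≫ (ρ_ (A ⊗ A)).hom ≫ coelt := by
        rw [MonoidalCategory.tensorHom_def', Category.assoc, unitors_equal, rightUnitor_naturality]
      rw [c, b, u]
      monoidal
    have inv : N.X ◁ (β_ P.X M.X).hom ≫ N.X ◁ (β_ M.X P.X).hom = 𝟙 _ := by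
      rw [← MonoidalCategory.whiskerLeft_comp, SymmetricCategory.symmetry, whiskerLeft_id]
    rw [← f] at t3
    have t3' := (Iso.comp_inv_eq _).2 t3
    have t1' := (Iso.eq_inv_comp _).2 t1
    have t2' := congrArg (fun t => t ≫ N.X ◁ (β_ M.X P.X).hom) t2
    simp only [Category.assoc, inv, Category.comp_id, t1'] at t2'
    rw [← t3', ← t2']
    simp only [Category.assoc]
  have k4 : act (ext (ext N P) M) (sndC A A ▷ A ≫ coelt) =
      (α_ N.X P.X M.X).hom ≫ N.X ◁ act (ext P M) coelt ≫ (α_ N.X P.X M.X).inv := by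
    have e := act_ext N (ext P M) ε[A] coelt
    rw [act_counit, id_tensorHom] at e
    have t := act_transport (ext (ext N P) M) (ext N (ext P M)) _ _ (ext_assoc N P M)
      ((ε[A] ⊗ₘ coelt) ≫ (λ_ (𝟙_ V)).hom)
    have f : sndC A A ▷ A ≫ coelt = (α_ A A A).hom ≫ (ε[A] ⊗ₘ coelt) ≫ (λ_ (𝟙_ V)).hom := by
      have u : (ε[A] ⊗ₘ coelt) ≫ (λ_ (𝟙_ V)).hom =
          ε[A] ▷ (A ⊗ A) ≫ (λ_ (A ⊗ A)).hom ≫ coelt := by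
        rw [MonoidalCategory.tensorHom_def, Category.assoc, leftUnitor_naturality]
      rw [sndC, u]
      monoidal
    have t' := (Iso.comp_inv_eq _).2 t
    rw [f, ← t', e, Category.assoc]
  have inv : N.X ◁ (β_ M.X P.X).hom ≫ N.X ◁ (β_ P.X M.X).hom = 𝟙 _ := by
    rw [← MonoidalCategory.whiskerLeft_comp, SymmetricCategory.symmetry, whiskerLeft_id]
  rw [braid_eq, key, k2, k3, k4, braid_eq, braid_eq]
  simp [reassoc_of% inv]

theorem hexagon_reverse (M N P : LeftComod A) :
    (α_ M.X N.X P.X).inv ≫ braid (tensor M N) P ≫ (α_ P.X M.X N.X).inv =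
      M.X ◁ braid N P ≫ (α_ M.X P.X N.X).inv ≫ braid M P ▷ N.X := by
  have key : act (ext P (tensor M N)) coelt =
      act (ext P (ext M N)) (A ◁ μ[A] ≫ coelt) := by
    have h := act_transport (ext P (ext M N)) (ext P (tensor M N)) _ _
      (ext_whiskerLeft P μ[A] (𝟙 _) (ext_tensor M N)) coelt
    simpa using h
  have k2 : act (ext P (ext M N)) (A ◁ μ[A] ≫ coelt) =
      act (ext P (ext M N)) (A ◁ sndC A A ≫ coelt) ≫
        act (ext P (ext M N)) (A ◁ fstC A A ≫ coelt) := by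
    rw [act_comp, ← Category.assoc Δ[A ⊗ A ⊗ A], comul_whiskerLeft, comul_snd_fst,
      coelt_mul_right]
    simp
  have k3 : act (ext P (ext M N)) (A ◁ sndC A A ≫ coelt) =
      (α_ P.X M.X N.X).inv ≫ (β_ P.X M.X).hom ▷ N.X ≫ (α_ M.X P.X N.X).hom ≫
       M.X ◁ act (ext P N) coelt ≫
      (α_ M.X P.X N.X).inv ≫ (β_ M.X P.X).hom ▷ N.X ≫ (α_ P.X M.X N.X).hom := by
    have e := act_ext M (ext P N) ε[A] coelt
    rw [act_counit, id_tensorHom] at e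
    have t1 := act_transport (ext (ext M P) N) (ext M (ext P N)) _ _ (ext_assoc M P N)
      ((ε[A] ⊗ₘ coelt) ≫ (λ_ (𝟙_ V)).hom)
    rw [e] at t1
    have t2 := act_transport (ext (ext P M) N) (ext (ext M P) N) _ _
      (ext_whiskerRight N (Q := ext P M) (Q' := ext M P) _ _ (ext_swap P M))
      ((α_ A A A).hom ≫ (ε[A] ⊗ₘ coelt) ≫ (λ_ (𝟙_ V)).hom)
    have t3 := act_transport (ext (ext P M) N) (ext P (ext M N)) _ _ (ext_assoc P M N)
      ((α_ A A A).inv ≫ (β_ A A).hom ▷ A ≫ (α_ A A A).hom ≫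
        (ε[A] ⊗ₘ coelt) ≫ (λ_ (𝟙_ V)).hom)
    have f : A ◁ sndC A A ≫ coelt = (α_ A A A).inv ≫ (β_ A A).hom ▷ A ≫ (α_ A A A).hom ≫
        (ε[A] ⊗ₘ coelt) ≫ (λ_ (𝟙_ V)).hom := by
      have b : A ◁ ε[A] ≫ (ρ_ A).hom = (β_ A A).hom ≫ ε[A] ▷ A ≫ (λ_ A).hom := by
        rw [← BraidedCategory.braiding_naturality_right_assoc, braiding_leftUnitor]
      have c : A ◁ sndC A A = (α_ A A A).inv ≫ (A ◁ ε[A] ≫ (ρ_ A).hom) ▷ A := by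
        rw [sndC]; monoidal
      have u : (ε[A] ⊗ₘ coelt) ≫ (λ_ (𝟙_ V)).hom =
          ε[A] ▷ (A ⊗ A) ≫ (λ_ (A ⊗ A)).hom ≫ coelt := by
        rw [MonoidalCategory.tensorHom_def, Category.assoc, leftUnitor_naturality]
      rw [c, b, u]
      monoidal
    have inv : (β_ P.X M.X).hom ▷ N.X ≫ (β_ M.X P.X).hom ▷ N.X = 𝟙 _ := by
      rw [← comp_whiskerRight, SymmetricCategory.symmetry, id_whiskerRight]
    rw [← f, f, Iso.hom_inv_id_assoc, ← f] at t3
    have t1' := (Iso.eq_comp_inv _).2 t1.symm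
    have t2' := congrArg (fun t => t ≫ (β_ M.X P.X).hom ▷ N.X) t2
    simp only [Category.assoc, inv, Category.comp_id, t1'] at t2'
    rw [← Iso.eq_inv_comp, ← t2'] at t3
    rw [t3]
    simp only [Category.assoc]
  have k4 : act (ext P (ext M N)) (A ◁ fstC A A ≫ coelt) =
      (α_ P.X M.X N.X).inv ≫ act (ext P M) coelt ▷ N.X ≫ (α_ P.X M.X N.X).hom := by
    have e := act_ext (ext P M) N coelt ε[A]
    rw [act_counit, tensorHom_id] at e
    have t := act_transport (ext (ext P M) N) (ext P (ext M N)) _ _ (ext_assoc P M N)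
      ((α_ A A A).inv ≫ (coelt ⊗ₘ ε[A]) ≫ (λ_ (𝟙_ V)).hom)
    have f : A ◁ fstC A A ≫ coelt = (α_ A A A).inv ≫ (coelt ⊗ₘ ε[A]) ≫ (λ_ (𝟙_ V)).hom := by
      have u : (coelt ⊗ₘ ε[A]) ≫ (λ_ (𝟙_ V)).hom =
          (A ⊗ A) ◁ ε[A] ≫ (ρ_ (A ⊗ A)).hom ≫ coelt := by
        rw [MonoidalCategory.tensorHom_def', Category.assoc, unitors_equal, rightUnitor_naturality]
      rw [fstC, u]
      monoidal
    rw [Iso.hom_inv_id_assoc, e, ← f, ← Iso.eq_inv_comp] at t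
    exact t
  have inv : (β_ M.X P.X).hom ▷ N.X ≫ (β_ P.X M.X).hom ▷ N.X = 𝟙 _ := by
    rw [← comp_whiskerRight, SymmetricCategory.symmetry, id_whiskerRight]
  rw [braid_eq, key, k2, k3, k4, braid_eq, braid_eq]
  simp [reassoc_of% inv]

/-- Comodules over a bimonoid with a braiding coelement form a braided monoidal category. -/
instance : BraidedCategory (LeftComod A) where
  braiding M N := mkIso (braidIso M N) (braid_comm M N)
  braiding_naturality_right M _ _ f :=
    hom_ext (by simpa [mkIso, braidIso] using braid_natural (𝟙 M) f)
  braiding_naturality_left f M :=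
    hom_ext (by simpa [mkIso, braidIso] using braid_natural f (𝟙 M))
  hexagon_forward M N P := hom_ext (hexagon_forward M N P)
  hexagon_reverse M N P := hom_ext (hexagon_reverse M N P)

theorem braiding_hom_hom (M N : LeftComod A) : (β_ M N).hom.hom =
    (β_ M.X N.X).hom ≫ (N.coact ⊗ₘ M.coact) ≫ tensorμ A N.X A M.X ≫
      BraidingCoelement.coelt ▷ (N.X ⊗ M.X) ≫ (λ_ (N.X ⊗ M.X)).hom := rfl

end Braiding
end LeftComod

namespace SemidirectProduct

section DistributiveLaws

variable {V : Type u} [Category.{v} V] [MonoidalCategory V]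

/-- A distributive law `τ : X ⊗ A ⟶ A ⊗ X` between comonoids: the compatibilities of `τ` with the
counits and comultiplications, given by `cX`, `dX` on `X` and by the comonoid `A`. -/
structure IsComonoidDistributiveLaw (A : V) [ComonObj A] (X : V) (cX : X ⟶ 𝟙_ V) (dX : X ⟶ X ⊗ X)
    (τ : X ⊗ A ⟶ A ⊗ X) : Prop where
  counit_left : τ ≫ ε[A] ▷ X ≫ (λ_ X).hom = X ◁ ε[A] ≫ (ρ_ X).hom
  counit_right : τ ≫ A ◁ cX ≫ (ρ_ A).hom = cX ▷ A ≫ (λ_ A).hom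
  comul_left : τ ≫ Δ[A] ▷ X =
    X ◁ Δ[A] ≫ (α_ X A A).inv ≫ τ ▷ A ≫ (α_ A X A).hom ≫ A ◁ τ ≫ (α_ A A X).inv
  comul_right : τ ≫ A ◁ dX =
    dX ▷ A ≫ (α_ X X A).hom ≫ X ◁ τ ≫ (α_ X A X).inv ≫ τ ▷ X ≫ (α_ A X X).hom

/-- A distributive law `s : A ⊗ X ⟶ X ⊗ A` between monoids: the compatibilities of `s` with the
units and multiplications, given by `uX`, `mX` on `X` and by the monoid `A`. -/
structure IsMonoidDistributiveLaw (A : V) [MonObj A] (X : V) (uX : 𝟙_ V ⟶ X) (mX : X ⊗ X ⟶ X)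
    (s : A ⊗ X ⟶ X ⊗ A) : Prop where
  unit_left : η[A] ▷ X ≫ s = (λ_ X).hom ≫ (ρ_ X).inv ≫ X ◁ η[A]
  unit_right : A ◁ uX ≫ s = (ρ_ A).hom ≫ (λ_ A).inv ≫ uX ▷ A
  mul_left : μ[A] ▷ X ≫ s =
    (α_ A A X).hom ≫ A ◁ s ≫ (α_ A X A).inv ≫ s ▷ A ≫ (α_ X A A).hom ≫ X ◁ μ[A]
  mul_right : A ◁ mX ≫ s =
    (α_ A X X).inv ≫ s ▷ X ≫ (α_ X A X).hom ≫ X ◁ s ≫ (α_ X X A).inv ≫ mX ▷ A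

end DistributiveLaws

section Structure

variable {V : Type u} [Category.{v} V] [MonoidalCategory V] [SymmetricCategory V] {A : V}
  [BimonObj A]

/-- The morphism `τ_X : x ⊗ a ↦ x₍₋₁₎a ⊗ x₍₀₎`. -/
def tau (X : LeftComod A) : X.X ⊗ A ⟶ A ⊗ X.X :=
  X.coact ▷ A ≫ (α_ A X.X A).hom ≫ A ◁ (β_ X.X A).hom ≫ (α_ A A X.X).inv ≫ μ[A] ▷ X.X

variable [BraidingCoelement A]

/-- The braiding of the comodule `A` (coacting on itself by comultiplication) with `X`, that is
`a ⊗ x ↦ γ(x₍₋₁₎ ⊗ a₁) x₍₀₎ ⊗ a₂`. -/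
def braid (X : LeftComod A) : A ⊗ X.X ⟶ X.X ⊗ A :=
  (β_ (LeftComod.regular A) X).hom.hom

variable (H : LeftComod A) [BimonObj H]

/-- The comultiplication of the semidirect product, induced by the distributive law `tau H`. -/
def comul : H.X ⊗ A ⟶ (H.X ⊗ A) ⊗ (H.X ⊗ A) :=
  (Δ[H].hom ⊗ₘ Δ[A]) ≫ (α_ H.X H.X (A ⊗ A)).hom ≫
    H.X ◁ ((α_ H.X A A).inv ≫ tau H ▷ A ≫ (α_ A H.X A).hom) ≫ (α_ H.X A (H.X ⊗ A)).inv

/-- The counit of the semidirect product. -/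
def counit : H.X ⊗ A ⟶ 𝟙_ V :=
  (ε[H].hom ⊗ₘ ε[A]) ≫ (λ_ (𝟙_ V)).hom

/-- The multiplication of the semidirect product, induced by the distributive law `braid H`. -/
def mul : (H.X ⊗ A) ⊗ (H.X ⊗ A) ⟶ H.X ⊗ A :=
  (α_ H.X A (H.X ⊗ A)).hom ≫ H.X ◁ ((α_ A H.X A).inv ≫ braid H ▷ A ≫ (α_ H.X A A).hom) ≫
    (α_ H.X H.X (A ⊗ A)).inv ≫ (μ[H].hom ⊗ₘ μ[A])

/-- The unit of the semidirect product. -/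
def one : 𝟙_ V ⟶ H.X ⊗ A :=
  (λ_ (𝟙_ V)).inv ≫ (η[H].hom ⊗ₘ η[A])

/-- The antipode of the semidirect product built from antipodes `sH` of `H` and `sA` of `A`,
`h ⊗ a ↦ γ(h₍₋₁₎ ⊗ sA(h₍₋₂₎a₂)) sH(h₍₀₎) ⊗ sA(h₍₋₃₎a₁)`. -/
def antipode {A : V} [BimonObj A] [BraidingCoelement A] (H : LeftComod A) (sH : H.X ⟶ H.X)
    (sA : A ⟶ A) : H.X ⊗ A ⟶ H.X ⊗ A :=
  -- `h ⊗ a ↦ (h₍₋₂₎ ⊗ (h₍₋₁₎ ⊗ h₍₀₎)) ⊗ a`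
  (H.coact ≫ A ◁ H.coact) ▷ A ≫
  -- move `a` to the second position
  (α_ A (A ⊗ H.X) A).hom ≫ A ◁ (β_ (A ⊗ H.X) A).hom ≫ (α_ A A (A ⊗ H.X)).inv ≫
  -- `x ⊗ a ↦ x₁ ⊗ a₁ ⊗ x₂ ⊗ a₂ ↦ sA(x₁a₁) ⊗ sA(x₂a₂)` on the first two factors
  ((Δ[A] ⊗ₘ Δ[A]) ≫ tensorμ A A A A ≫ (μ[A] ⊗ₘ μ[A]) ≫ (sA ⊗ₘ sA)) ▷ (A ⊗ H.X) ≫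
  -- apply `γ` to `h₍₋₁₎` and the second of these
  (α_ A A (A ⊗ H.X)).hom ≫
  A ◁ ((α_ A A H.X).inv ≫ ((β_ A A).hom ≫ BraidingCoelement.coelt) ▷ H.X ≫ (λ_ H.X).hom) ≫
  -- apply `sH` and exchange the two remaining factors
  A ◁ sH ≫ (β_ A H.X).hom

end Structure

end SemidirectProduct

/-! Write W for the category of `A`-comodules. Tensoring the regular comodule `A` with a trivial
comodule `Y` gives the cofree comodule on `Y`, and a colinear map into it is determined by its
composite with the counit of `A`.

Comonoid law. `tau X` is the coaction of `X ⊗ A` followed by the counit on the last factor, so it is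
the colinear map from `X ⊗ A` to the cofree comodule on `X` whose composite with the counit discards
`A`. Its compatibility with Δ of `A` is colinearity itself. Naturality in `X` and the formulas at
the unit and at tensor products follow by uniqueness (`tau_natural`, `tau_unit`, `tau_tensor`);
taken at ε and Δ of `H` they give the other two axioms. The monoid law is naturality of a braiding
plus the hexagons.

Bimonoid. The product on `H ⊗ A` is that of the braided tensor product of the monoids `H` and `A` in
W. The coproduct is the colinear map `comulHom`: comultiply `H`, then coact on `H ⊗ A`, whose second
copy is placed in a trivial comodule. Both stages are monoid morphisms in W: the first because `H`
is a bimonoid there, the second because the coaction of a monoid in W is multiplicative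
(`isMonHom_coactHom`). Braiding past a trivial comodule is the symmetry of V (`braiding_triv`), so
the product on the target is the ordinary tensor product of monoids in V, and multiplicativity in W
is the bimonoid axiom in V. Neither γ nor elements need to be computed with.

Antipode. For arbitrary distributive laws τ and s, the map τ, then the two antipodes, then s is a
convolution inverse of the identity (`wreath_antipode_left`, `wreath_antipode_right`). It agrees
with the stated formula because the antipode of `A` reverses comultiplication and that of `H` is
colinear (`antipode_eq`). -/

namespace LeftComod

/-! ### Trivial and cofree comodules, and the braiding with trivial ones. -/

section Trivial

variable {V : Type u} [Category.{v} V] [MonoidalCategory V] [SymmetricCategory V] {A : V}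
  [BimonObj A]

variable (A) in
/-- An object of `V`, as a comodule with trivial coaction `y ↦ 1 ⊗ y`. -/
@[reducible]
def triv (Y : V) : LeftComod A where
  X := Y
  coact := (λ_ Y).inv ≫ η[A] ▷ Y
  coact_counit := by
    rw [Category.assoc, ← comp_whiskerRight, BimonObj.one_counit, id_whiskerRight,
      Category.comp_id]
  coact_comul := by
    rw [Category.assoc, ← comp_whiskerRight, Bimon.one_comul]
    simp only [MonoidalCategory.tensorHom_def, comp_whiskerRight,
      MonoidalCategory.whiskerLeft_comp, Category.assoc]
    rw [← whisker_exchange_assoc]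
    monoidal

variable (A) in
/-- A morphism of `V`, as a morphism between comodules with trivial coaction. -/
@[simps]
def trivMap {Y Z : V} (f : Y ⟶ Z) : triv A Y ⟶ triv A Z where
  hom := f
  comm := by
    change ((λ_ Y).inv ≫ η[A] ▷ Y) ≫ A ◁ f = f ≫ (λ_ Z).inv ≫ η[A] ▷ Z
    rw [Category.assoc, ← whisker_exchange, leftUnitor_inv_naturality_assoc]

theorem tensorμ_unit_right (X₁ X₂ Y : V) :
    (X₁ ⊗ X₂) ◁ (λ_ Y).inv ≫ tensorμ X₁ X₂ (𝟙_ V) Y =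
      (α_ X₁ X₂ Y).hom ≫ (ρ_ X₁).inv ▷ (X₂ ⊗ Y) := by
  rw [tensorμ, braiding_tensorUnit_right]
  monoidal

/-- Triviality is a hypothesis on the coaction, so that the unit comodule, whose coaction is written
with the right unitor, is covered along with `triv A Y`. -/
theorem extCoact_of_trivial {C : V} [ComonObj C] (N : LeftComod C) (M : LeftComod A)
    (h : M.coact = (λ_ M.X).inv ≫ η[A] ▷ M.X) :
    extCoact N M = N.coact ▷ M.X ≫ (α_ C N.X M.X).hom ≫
      ((ρ_ C).inv ≫ C ◁ η[A]) ▷ (N.X ⊗ M.X) := by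
  have h2 := tensorμ_whiskerRight (𝟙 C) η[A] N.X M.X
  rw [id_whiskerRight, id_tensorHom, id_tensorHom] at h2
  rw [extCoact, h, MonoidalCategory.tensorHom_def, MonoidalCategory.whiskerLeft_comp,
    Category.assoc, Category.assoc, h2, reassoc_of% tensorμ_unit_right, comp_whiskerRight]

theorem tensor_triv_coact (N : LeftComod A) (Y : V) :
    (N ⊗ triv A Y).coact = N.coact ▷ Y ≫ (α_ A N.X Y).hom := by
  change tensorCoact N (triv A Y) = _
  rw [tensorCoact_eq, extCoact_of_trivial N (triv A Y) rfl]
  simp only [Category.assoc, ← comp_whiskerRight, MonObj.mul_one]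
  rw [Iso.inv_hom_id, id_whiskerRight, Category.comp_id]

/-- The coaction of `M`, as a morphism from `M` to the cofree comodule `A ⊗ M`. -/
@[simps]
def coactHom (M : LeftComod A) : M ⟶ regular A ⊗ triv A M.X where
  hom := M.coact
  comm := by
    rw [tensor_triv_coact]
    change M.coact ≫ A ◁ M.coact = M.coact ≫ Δ[A] ▷ M.X ≫ (α_ A A M.X).hom
    rw [coact_comul_assoc, Iso.inv_hom_id, Category.comp_id]

/-- Colinearity moves the coaction to the far side of `k`, where it becomes Δ, and the counit law of
`A` cancels it. -/
theorem eq_coact_comp_of_cofree {M : LeftComod A} {Y : V} (k : M.X ⟶ A ⊗ Y)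
    (hk : M.coact ≫ A ◁ k = k ≫ Δ[A] ▷ Y ≫ (α_ A A Y).hom) :
    k = M.coact ≫ A ◁ (k ≫ ε[A] ▷ Y ≫ (λ_ Y).hom) := by
  have h2 : Δ[A] ▷ Y ≫ (α_ A A Y).hom ≫ A ◁ (ε[A] ▷ Y ≫ (λ_ Y).hom) = 𝟙 (A ⊗ Y) := by
    have h3 := congrArg (fun t => t ▷ Y ≫ (ρ_ A).hom ▷ Y) (ComonObj.comul_counit A)
    simp only [← comp_whiskerRight, Category.assoc, Iso.inv_hom_id, id_whiskerRight] at h3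
    rw [← h3]
    monoidal
  rw [MonoidalCategory.whiskerLeft_comp, reassoc_of% hk, h2, Category.comp_id]

/-- A morphism to a cofree comodule is determined by its composite with the counit of `A`. -/
theorem hom_eq_of_cofree {M : LeftComod A} {Y : V} (f g : M ⟶ regular A ⊗ triv A Y)
    {f' g' : M.X ⟶ A ⊗ Y} (hf : f.hom = f') (hg : g.hom = g')
    (h : f' ≫ ε[A] ▷ Y = g' ≫ ε[A] ▷ Y) : f' = g' := by
  have key (k : M ⟶ regular A ⊗ triv A Y) :
      M.coact ≫ A ◁ k.hom = k.hom ≫ Δ[A] ▷ Y ≫ (α_ A A Y).hom := by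
    rw [k.comm, tensor_triv_coact]
    rfl
  have hf' := key f
  have hg' := key g
  rw [hf] at hf'
  rw [hg] at hg'
  rw [eq_coact_comp_of_cofree f' hf', eq_coact_comp_of_cofree g' hg', reassoc_of% h]

variable [BraidingCoelement A]

/-- In any braided category the braiding with the unit object is forced to be made of unitors. In W
it is also the swap followed by the action of γ(- ⊗ 1), so that action is trivial. -/
theorem act_coelt_one (N : LeftComod A) :
    act N ((ρ_ A).inv ≫ A ◁ η[A] ≫ BraidingCoelement.coelt) = 𝟙 N.X := by
  have h := congrArg Hom.hom (braiding_tensorUnit_left N)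
  change braid (unit A) N = (λ_ N.X).hom ≫ (ρ_ N.X).inv at h
  have e : (unit A).coact = (λ_ (𝟙_ V)).inv ≫ η[A] ▷ 𝟙_ V := by
    change η[A] ≫ (ρ_ A).inv = (λ_ (𝟙_ V)).inv ≫ η[A] ▷ 𝟙_ V
    rw [unitors_inv_equal, rightUnitor_inv_naturality]
  have h' : (β_ (𝟙_ V) N.X).hom ≫ extCoact N (unit A) ≫
      BraidingCoelement.coelt ▷ (N.X ⊗ 𝟙_ V) ≫ (λ_ (N.X ⊗ 𝟙_ V)).hom = (β_ (𝟙_ V) N.X).hom :=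
    (braid_eq (unit A) N).symm.trans (h.trans (braiding_tensorUnit_left N.X).symm)
  rw [extCoact_of_trivial N (unit A) e, ← cancel_epi (β_ (𝟙_ V) N.X).inv,
    Iso.inv_hom_id_assoc, Iso.inv_hom_id] at h'
  rw [← cancel_mono (ρ_ N.X).inv, Category.id_comp, rightUnitor_inv_naturality, act,
    ← cancel_epi (ρ_ N.X).hom, Iso.hom_inv_id, ← h']
  monoidal

theorem braiding_triv (Y : V) (N : LeftComod A) : (β_ (triv A Y) N).hom.hom = (β_ Y N.X).hom := by
  have h := congrArg (fun t => t ▷ Y) (act_coelt_one N)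
  simp only [act, id_whiskerRight] at h
  have e : extCoact N (triv A Y) ≫ BraidingCoelement.coelt ▷ (N.X ⊗ Y) ≫ (λ_ (N.X ⊗ Y)).hom =
      𝟙 (N.X ⊗ Y) := by
    rw [extCoact_of_trivial N (triv A Y) rfl, ← h]
    monoidal
  calc
    _ = (β_ Y N.X).hom ≫ extCoact N (triv A Y) ≫ BraidingCoelement.coelt ▷ (N.X ⊗ Y) ≫
        (λ_ (N.X ⊗ Y)).hom := braid_eq (triv A Y) N
    _ = _ := by rw [e, Category.comp_id]

end Trivial
end LeftComod

namespace SemidirectProduct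

/-! ### The distributive law between comonoids. -/

section Tau

variable {V : Type u} [Category.{v} V] [MonoidalCategory V] [SymmetricCategory V] {A : V}
  [BimonObj A]

open LeftComod

/-- The coaction `x ⊗ a ↦ x₍₋₁₎a₁ ⊗ x₍₀₎ ⊗ a₂` on the tensor product of `X` with the regular
comodule. -/
def coactRegular (X : LeftComod A) : X.X ⊗ A ⟶ A ⊗ (X.X ⊗ A) :=
  (X ⊗ regular A).coact

theorem coactRegular_eq (X : LeftComod A) :
    coactRegular X = X.X ◁ Δ[A] ≫ (α_ X.X A A).inv ≫ tau X ▷ A ≫ (α_ A X.X A).hom := by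
  change (X.coact ⊗ₘ Δ[A]) ≫ tensorμ A X.X A A ≫ μ[A] ▷ (X.X ⊗ A) = _
  rw [tau, tensorμ, MonoidalCategory.tensorHom_def']
  monoidal

theorem coactRegular_counit (X : LeftComod A) :
    coactRegular X ≫ ε[A] ▷ (X.X ⊗ A) = (λ_ (X.X ⊗ A)).inv :=
  (X ⊗ regular A).coact_counit

/-- The morphism `tau X`, as a morphism of comodules to a cofree comodule. -/
def tauHom (X : LeftComod A) : X ⊗ regular A ⟶ regular A ⊗ triv A X.X :=
  coactHom (X ⊗ regular A) ≫ regular A ◁ trivMap A (X.X ◁ ε[A] ≫ (ρ_ X.X).hom)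

/-- Discarding a₂ from x₍₋₁₎a₁ ⊗ x₍₀₎ ⊗ a₂ leaves x₍₋₁₎a ⊗ x₍₀₎. This presents `tau X` as the
underlying map of `tauHom X`. -/
theorem tau_eq (X : LeftComod A) :
    tau X = coactRegular X ≫ A ◁ (X.X ◁ ε[A] ≫ (ρ_ X.X).hom) := by
  rw [coactRegular_eq]
  calc
    _ = X.X ◁ (Δ[A] ≫ A ◁ ε[A]) ≫ (α_ X.X A (𝟙_ V)).inv ≫ tau X ▷ 𝟙_ V ≫ (ρ_ _).hom := by
      rw [ComonObj.comul_counit, rightUnitor_naturality]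
      monoidal
    _ = X.X ◁ Δ[A] ≫ (α_ X.X A A).inv ≫ ((X.X ⊗ A) ◁ ε[A] ≫ tau X ▷ 𝟙_ V) ≫ (ρ_ _).hom := by
      monoidal
    _ = _ := by
      rw [whisker_exchange]
      monoidal

theorem tauHom_hom (X : LeftComod A) : (tauHom X).hom = tau X :=
  (tau_eq X).symm

theorem tau_counit (X : LeftComod A) : tau X ≫ ε[A] ▷ X.X ≫ (λ_ X.X).hom =
    X.X ◁ ε[A] ≫ (ρ_ X.X).hom := by
  rw [tau_eq, Category.assoc, whisker_exchange_assoc, leftUnitor_naturality,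
    reassoc_of% coactRegular_counit, Iso.inv_hom_id_assoc]

/-- This is the colinearity of `tauHom X`, with both coactions written out. -/
theorem tau_comul (X : LeftComod A) : tau X ≫ Δ[A] ▷ X.X =
    X.X ◁ Δ[A] ≫ (α_ X.X A A).inv ≫ tau X ▷ A ≫ (α_ A X.X A).hom ≫ A ◁ tau X ≫
      (α_ A A X.X).inv := by
  have h := (tauHom X).comm
  rw [tensor_triv_coact, tauHom_hom] at h
  have h' : coactRegular X ≫ A ◁ tau X = tau X ≫ Δ[A] ▷ X.X ≫ (α_ A A X.X).hom := h
  rw [coactRegular_eq] at h'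
  rw [← cancel_mono (α_ A A X.X).hom]
  simpa using h'.symm

/-- Both sides are colinear into the cofree comodule on `Y.X`; after the counit of `A` both become
`f` with `A` discarded. -/
theorem tau_natural {X Y : LeftComod A} (f : X ⟶ Y) :
    tau X ≫ A ◁ f.hom = f.hom ▷ A ≫ tau Y := by
  have h : (tau X ≫ A ◁ f.hom) ≫ ε[A] ▷ Y.X = (f.hom ▷ A ≫ tau Y) ≫ ε[A] ▷ Y.X := by
    rw [← cancel_mono (λ_ Y.X).hom]
    simp only [Category.assoc]
    rw [tau_counit, whisker_exchange_assoc, leftUnitor_naturality, reassoc_of% tau_counit X,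
      ← whisker_exchange_assoc, rightUnitor_naturality]
  refine hom_eq_of_cofree (tauHom X ≫ regular A ◁ trivMap A f.hom) (f ▷ regular A ≫ tauHom Y)
    ?_ ?_ h
  · rw [comp_hom, tauHom_hom]; rfl
  · rw [comp_hom, tauHom_hom]; rfl

theorem tau_unit : tau (𝟙_ (LeftComod A)) = (λ_ A).hom ≫ (ρ_ A).inv := by
  have h : tau (𝟙_ (LeftComod A)) ≫ ε[A] ▷ 𝟙_ V =
      ((λ_ A).hom ≫ (ρ_ A).inv) ≫ ε[A] ▷ 𝟙_ V := by
    have h := tau_counit (𝟙_ (LeftComod A))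
    change tau (𝟙_ (LeftComod A)) ≫ ε[A] ▷ 𝟙_ V ≫ (λ_ (𝟙_ V)).hom =
      𝟙_ V ◁ ε[A] ≫ (ρ_ (𝟙_ V)).hom at h
    rw [← cancel_mono (λ_ (𝟙_ V)).hom, Category.assoc]
    refine h.trans ?_
    rw [← unitors_equal, leftUnitor_naturality]
    simp only [Category.assoc]
    rw [← rightUnitor_inv_naturality_assoc, unitors_equal, Iso.inv_hom_id, Category.comp_id]
  refine hom_eq_of_cofree (M := 𝟙_ (LeftComod A) ⊗ regular A) (tauHom _)
    ((λ_ (regular A)).hom ≫ coactHom (regular A) ≫ regular A ◁ trivMap A ε[A]) (tauHom_hom _) ?_ h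
  change (λ_ A).hom ≫ Δ[A] ≫ A ◁ ε[A] = _
  rw [ComonObj.comul_counit]

theorem tau_tensor (X Y : LeftComod A) : tau (X ⊗ Y) =
    (α_ X.X Y.X A).hom ≫ X.X ◁ tau Y ≫ (α_ X.X A Y.X).inv ≫ tau X ▷ Y.X ≫
      (α_ A X.X Y.X).hom := by
  -- A tensor product of trivial comodules is again trivial, but its coaction has to be simplified
  -- by 1 · 1 = 1. This identity map supplies the comparison, so that both composites end in the
  -- same cofree comodule.
  let cmp : triv A X.X ⊗ triv A Y.X ⟶ triv A (X.X ⊗ Y.X) :=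
    { hom := 𝟙 (X.X ⊗ Y.X)
      comm := by
        rw [tensor_triv_coact]
        change (((λ_ X.X).inv ≫ η[A] ▷ X.X) ▷ Y.X ≫ (α_ A X.X Y.X).hom) ≫ A ◁ 𝟙 (X.X ⊗ Y.X) =
          𝟙 (X.X ⊗ Y.X) ≫ (λ_ (X.X ⊗ Y.X)).inv ≫ η[A] ▷ (X.X ⊗ Y.X)
        monoidal }
  have h : (tau (X ⊗ Y) : (X.X ⊗ Y.X) ⊗ A ⟶ A ⊗ (X.X ⊗ Y.X)) ≫ ε[A] ▷ (X.X ⊗ Y.X) =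
      ((α_ X.X Y.X A).hom ≫ X.X ◁ tau Y ≫ (α_ X.X A Y.X).inv ≫ tau X ▷ Y.X ≫
        (α_ A X.X Y.X).hom) ≫ ε[A] ▷ (X.X ⊗ Y.X) := by
    rw [← cancel_mono (λ_ (X.X ⊗ Y.X)).hom, Category.assoc]
    refine (tau_counit (X ⊗ Y)).trans ?_
    calc
      (X.X ⊗ Y.X) ◁ ε[A] ≫ (ρ_ (X.X ⊗ Y.X)).hom =
          (α_ X.X Y.X A).hom ≫ X.X ◁ (Y.X ◁ ε[A] ≫ (ρ_ Y.X).hom) := by monoidal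
      _ = (α_ X.X Y.X A).hom ≫ X.X ◁ tau Y ≫ (α_ X.X A Y.X).inv ≫
          (X.X ◁ ε[A] ≫ (ρ_ X.X).hom) ▷ Y.X := by rw [← tau_counit]; monoidal
      _ = _ := by rw [← tau_counit]; monoidal
  refine hom_eq_of_cofree (M := (X ⊗ Y) ⊗ regular A) (tauHom (X ⊗ Y))
    ((α_ X Y (regular A)).hom ≫ X ◁ tauHom Y ≫ (α_ X (regular A) (triv A Y.X)).inv ≫
      tauHom X ▷ triv A Y.X ≫ (α_ (regular A) (triv A X.X) (triv A Y.X)).hom ≫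
      regular A ◁ cmp) (tauHom_hom _) ?_ h
  simp only [comp_hom, whiskerLeft_hom, whiskerRight_hom, tauHom_hom]
  change (α_ X.X Y.X A).hom ≫ X.X ◁ tau Y ≫ (α_ X.X A Y.X).inv ≫ tau X ▷ Y.X ≫
    (α_ A X.X Y.X).hom ≫ A ◁ 𝟙 (X.X ⊗ Y.X) = _
  rw [whiskerLeft_id, Category.comp_id]

theorem isComonoidDistributiveLaw_tau (H : LeftComod A) [ComonObj H] :
    IsComonoidDistributiveLaw A H.X ε[H].hom Δ[H].hom (tau H) where
  counit_left := tau_counit H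
  counit_right := by
    have h := tau_natural ε[H]
    rw [tau_unit] at h
    have h' : tau H ≫ A ◁ ε[H].hom = ε[H].hom ▷ A ≫ (λ_ A).hom ≫ (ρ_ A).inv := h
    calc
      _ = (tau H ≫ A ◁ ε[H].hom) ≫ (ρ_ A).hom := (Category.assoc _ _ _).symm
      _ = _ := by rw [h']; simp
  comul_left := tau_comul H
  comul_right := by
    have h := tau_natural Δ[H]
    rw [tau_tensor] at h
    exact h

end Tau
-- Products, coproducts and antipodes from distributive laws in a monoidal category.
section Wreath

variable {V : Type u} [Category.{v} V] [MonoidalCategory V] {A X : V}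

/-- The comultiplication on `X ⊗ A` induced by a morphism `τ : X ⊗ A ⟶ A ⊗ X`. -/
def wreathComul [ComonObj A] [ComonObj X] (τ : X ⊗ A ⟶ A ⊗ X) : X ⊗ A ⟶ (X ⊗ A) ⊗ (X ⊗ A) :=
  (Δ[X] ⊗ₘ Δ[A]) ≫ (α_ X X (A ⊗ A)).hom ≫
    X ◁ ((α_ X A A).inv ≫ τ ▷ A ≫ (α_ A X A).hom) ≫ (α_ X A (X ⊗ A)).inv

/-- The multiplication on `X ⊗ A` induced by a morphism `s : A ⊗ X ⟶ X ⊗ A`. -/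
def wreathMul [MonObj A] [MonObj X] (s : A ⊗ X ⟶ X ⊗ A) : (X ⊗ A) ⊗ (X ⊗ A) ⟶ X ⊗ A :=
  (α_ X A (X ⊗ A)).hom ≫ X ◁ ((α_ A X A).inv ≫ s ▷ A ≫ (α_ X A A).hom) ≫
    (α_ X X (A ⊗ A)).inv ≫ (μ[X] ⊗ₘ μ[A])

section Comonoid

variable [ComonObj A] [ComonObj X] {τ : X ⊗ A ⟶ A ⊗ X}
  (h : IsComonoidDistributiveLaw A X ε[X] Δ[X] τ)
include h

theorem wreathComul_counit_left :
    wreathComul τ ≫ ((ε[X] ⊗ₘ ε[A]) ≫ (λ_ (𝟙_ V)).hom) ▷ (X ⊗ A) = (λ_ (X ⊗ A)).inv := by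
  have e1 : (τ ≫ ε[A] ▷ X ≫ (λ_ X).hom) ▷ A = (X ◁ ε[A] ≫ (ρ_ X).hom) ▷ A := by
    rw [h.counit_left]
  rw [wreathComul, MonoidalCategory.tensorHom_def, MonoidalCategory.tensorHom_def]
  calc
    _ = Δ[X] ▷ A ⊗≫ (X ⊗ X) ◁ Δ[A] ⊗≫ X ◁ (τ ▷ A) ⊗≫ (ε[X] ▷ (A ⊗ X ⊗ A) ≫
          𝟙_ V ◁ (ε[A] ▷ (X ⊗ A))) ⊗≫ 𝟙 _ := by monoidal
    _ = Δ[X] ▷ A ⊗≫ (X ⊗ X) ◁ Δ[A] ⊗≫ X ◁ ((τ ≫ ε[A] ▷ X ≫ (λ_ X).hom) ▷ A) ⊗≫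
          ε[X] ▷ (X ⊗ A) ⊗≫ 𝟙 _ := by
      rw [← whisker_exchange]; monoidal
    _ = Δ[X] ▷ A ⊗≫ (X ⊗ X) ◁ (Δ[A] ≫ ε[A] ▷ A) ⊗≫ ε[X] ▷ (X ⊗ A) ⊗≫ 𝟙 _ := by
      rw [e1]; monoidal
    _ = (Δ[X] ≫ ε[X] ▷ X) ▷ A ⊗≫ 𝟙 _ := by rw [ComonObj.counit_comul]; monoidal
    _ = _ := by rw [ComonObj.counit_comul]; monoidal

theorem wreathComul_counit_right :
    wreathComul τ ≫ (X ⊗ A) ◁ ((ε[X] ⊗ₘ ε[A]) ≫ (λ_ (𝟙_ V)).hom) = (ρ_ (X ⊗ A)).inv := by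
  have e1 : X ◁ (τ ≫ A ◁ ε[X] ≫ (ρ_ A).hom) = X ◁ (ε[X] ▷ A ≫ (λ_ A).hom) := by
    rw [h.counit_right]
  rw [wreathComul, MonoidalCategory.tensorHom_def', MonoidalCategory.tensorHom_def']
  calc
    _ = X ◁ Δ[A] ⊗≫ Δ[X] ▷ (A ⊗ A) ⊗≫ X ◁ (τ ▷ A) ⊗≫ (((X ⊗ A) ⊗ X) ◁ ε[A] ≫
          ((X ⊗ A) ◁ ε[X]) ▷ (𝟙_ V)) ⊗≫ 𝟙 _ := by monoidal
    _ = X ◁ Δ[A] ⊗≫ Δ[X] ▷ (A ⊗ A) ⊗≫ (X ◁ (τ ≫ A ◁ ε[X] ≫ (ρ_ A).hom)) ▷ A ⊗≫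
          (X ⊗ A) ◁ ε[A] ⊗≫ 𝟙 _ := by
      rw [whisker_exchange ((X ⊗ A) ◁ ε[X]) ε[A]]; monoidal
    _ = X ◁ Δ[A] ⊗≫ (Δ[X] ≫ X ◁ ε[X]) ▷ (A ⊗ A) ⊗≫ (X ⊗ A) ◁ ε[A] ⊗≫ 𝟙 _ := by
      rw [e1]; monoidal
    _ = X ◁ (Δ[A] ≫ A ◁ ε[A]) ⊗≫ 𝟙 _ := by rw [ComonObj.comul_counit]; monoidal
    _ = _ := by rw [ComonObj.comul_counit]; monoidal

/-- Both sides reduce to the iterated comultiplications of `X` and `A` followed by three copies of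
τ. On the left, τ is pushed past Δ of `X` by `comul_right`; on the right, past Δ of `A` by
`comul_left`; coassociativity matches the results. -/
theorem wreathComul_assoc :
    wreathComul τ ≫ (X ⊗ A) ◁ wreathComul τ =
      wreathComul τ ≫ wreathComul τ ▷ (X ⊗ A) ≫ (α_ (X ⊗ A) (X ⊗ A) (X ⊗ A)).hom := by
  have w : wreathComul τ = Δ[X] ▷ A ⊗≫ (X ⊗ X) ◁ Δ[A] ⊗≫ X ◁ (τ ▷ A) ⊗≫ 𝟙 _ := by
    rw [wreathComul, MonoidalCategory.tensorHom_def]; monoidal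
  have e1 := h.comul_right
  have e2 : τ ≫ Δ[A] ▷ X = X ◁ Δ[A] ⊗≫ τ ▷ A ⊗≫ A ◁ τ ⊗≫ 𝟙 ((A ⊗ A) ⊗ X) := by
    rw [h.comul_left]; monoidal
  calc
    _ = Δ[X] ▷ A ⊗≫ (X ⊗ X) ◁ Δ[A] ⊗≫ X ◁ ((τ ≫ A ◁ Δ[X]) ▷ A) ⊗≫
          ((X ⊗ A) ⊗ (X ⊗ X)) ◁ Δ[A] ⊗≫ (X ⊗ A) ◁ (X ◁ (τ ▷ A)) ⊗≫ 𝟙 _ := by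
      rw [w]; monoidal
    _ = Δ[X] ▷ A ⊗≫ ((X ⊗ X) ◁ Δ[A] ≫ (X ◁ Δ[X]) ▷ (A ⊗ A)) ⊗≫ X ◁ (X ◁ τ ▷ A) ⊗≫
          (X ◁ (τ ▷ X) ▷ A ⊗≫
          ((X ⊗ A) ⊗ (X ⊗ X)) ◁ Δ[A]) ⊗≫ (X ⊗ A) ◁ (X ◁ (τ ▷ A)) ⊗≫ 𝟙 _ := by
      rw [e1]; monoidal
    _ = (Δ[X] ≫ X ◁ Δ[X]) ▷ A ⊗≫ (X ⊗ X ⊗ X) ◁ Δ[A] ⊗≫ (X ◁ (X ◁ τ) ▷ A ⊗≫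
          ((X ⊗ X ⊗ A) ⊗ X) ◁ Δ[A]) ⊗≫ ((X ◁ τ) ▷ ((X ⊗ A) ⊗ A) ≫
          (X ⊗ A ⊗ X) ◁ (τ ▷ A)) ⊗≫ 𝟙 _ := by
      -- Here and below, maps on disjoint factors are interchanged explicitly; `monoidal` accounts
      -- only for coherence.
      have a := whisker_exchange (X ◁ Δ[X]) Δ[A]
      have b := whisker_exchange (X ◁ (τ ▷ X)) Δ[A]
      calc
        _ = Δ[X] ▷ A ⊗≫ ((X ⊗ X) ◁ Δ[A] ≫ (X ◁ Δ[X]) ▷ (A ⊗ A)) ⊗≫ X ◁ (X ◁ τ ▷ A) ⊗≫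
          ((X ◁ (τ ▷ X)) ▷ A ≫
          (X ⊗ (A ⊗ X) ⊗ X) ◁ Δ[A]) ⊗≫ (X ⊗ A) ◁ (X ◁ (τ ▷ A)) ⊗≫ 𝟙 _ := by monoidal
        _ = _ := by rw [a, ← b]; monoidal
    _ = (Δ[X] ≫ X ◁ Δ[X]) ▷ A ⊗≫ (X ⊗ X ⊗ X) ◁ (Δ[A] ≫ A ◁ Δ[A]) ⊗≫ (X ◁ (X ◁ τ)) ▷ (A ⊗ A) ⊗≫
          (X ⊗ X ⊗ A) ◁ (τ ▷ A) ⊗≫ (X ◁ τ) ▷ (A ⊗ X ⊗ A) ⊗≫ 𝟙 _ := by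
      have a := whisker_exchange (X ◁ (X ◁ τ)) Δ[A]
      have b := whisker_exchange (X ◁ τ) (τ ▷ A)
      calc
        _ = (Δ[X] ≫ X ◁ Δ[X]) ▷ A ⊗≫ (X ⊗ X ⊗ X) ◁ Δ[A] ⊗≫ ((X ◁ (X ◁ τ)) ▷ A ≫
          (X ⊗ X ⊗ (A ⊗ X)) ◁ Δ[A]) ⊗≫ ((X ◁ τ) ▷ ((X ⊗ A) ⊗ A) ≫
          (X ⊗ A ⊗ X) ◁ (τ ▷ A)) ⊗≫ 𝟙 _ := by monoidal
        _ = _ := by rw [← a, ← b]; monoidal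
    _ = (Δ[X] ≫ Δ[X] ▷ X) ▷ A ⊗≫ (X ⊗ X ⊗ X) ◁ (Δ[A] ≫ Δ[A] ▷ A) ⊗≫ (X ◁ (X ◁ τ)) ▷ (A ⊗ A) ⊗≫
          (X ⊗ X ⊗ A) ◁ (τ ▷ A) ⊗≫ (X ◁ τ) ▷ (A ⊗ X ⊗ A) ⊗≫ 𝟙 _ := by
      rw [ComonObj.comul_assoc, ComonObj.comul_assoc]; monoidal
    _ = (Δ[X] ≫ Δ[X] ▷ X) ▷ A ⊗≫ (X ⊗ X ⊗ X) ◁ Δ[A] ⊗≫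
          (X ⊗ X) ◁ ((X ◁ Δ[A] ⊗≫ τ ▷ A ⊗≫ A ◁ τ ⊗≫ 𝟙 ((A ⊗ A) ⊗ X)) ▷ A) ⊗≫
          (X ◁ τ) ▷ (A ⊗ X ⊗ A) ⊗≫ 𝟙 _ := by monoidal
    _ = Δ[X] ▷ A ⊗≫ (Δ[X] ▷ (X ⊗ A) ≫ (X ⊗ X) ◁ (X ◁ Δ[A])) ⊗≫
          (X ⊗ X) ◁ ((τ ≫ Δ[A] ▷ X) ▷ A) ⊗≫
          (X ◁ τ) ▷ (A ⊗ X ⊗ A) ⊗≫ 𝟙 _ := by rw [e2]; monoidal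
    _ = Δ[X] ▷ A ⊗≫ (X ⊗ X) ◁ Δ[A] ⊗≫ (Δ[X] ▷ ((X ⊗ A) ⊗ A) ≫
          (X ⊗ X) ◁ (τ ▷ A)) ⊗≫ (X ⊗ X) ◁ (Δ[A] ▷ (X ⊗ A)) ⊗≫
          (X ◁ τ) ▷ (A ⊗ X ⊗ A) ⊗≫ 𝟙 _ := by
      rw [← whisker_exchange]; monoidal
    _ = _ := by rw [← whisker_exchange, w]; monoidal

end Comonoid

section Antipode

variable [MonObj A] [ComonObj A] [MonObj X] [ComonObj X] {τ : X ⊗ A ⟶ A ⊗ X}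
  {s : A ⊗ X ⟶ X ⊗ A} (h : IsComonoidDistributiveLaw A X ε[X] Δ[X] τ)
  (h' : IsMonoidDistributiveLaw A X η[X] μ[X] s) {sA : A ⟶ A} {sX : X ⟶ X}
include h h'

/-- The τ of the coproduct and the τ of the antipode combine, by `comul_right`, into one τ followed
by Δ of `X`; dually the two copies of s combine by `mul_right`. The antipode of `X` then cancels
between them, the counit and unit axioms remove τ and s, and the antipode of `A` cancels last. -/
theorem wreath_antipode_left (hA : Δ[A] ≫ sA ▷ A ≫ μ[A] = ε[A] ≫ η[A])
    (hX : Δ[X] ≫ sX ▷ X ≫ μ[X] = ε[X] ≫ η[X]) :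
    wreathComul τ ≫ (τ ≫ (sA ⊗ₘ sX) ≫ s) ▷ (X ⊗ A) ≫ wreathMul s =
      ((ε[X] ⊗ₘ ε[A]) ≫ (λ_ (𝟙_ V)).hom) ≫ (λ_ (𝟙_ V)).inv ≫ (η[X] ⊗ₘ η[A]) := by
  rw [wreathComul, wreathMul, MonoidalCategory.tensorHom_def' Δ[X],
    MonoidalCategory.tensorHom_def μ[X], MonoidalCategory.tensorHom_def sA]
  calc
    _ = X ◁ Δ[A] ⊗≫ (Δ[X] ▷ A ≫ (α_ X X A).hom ≫ X ◁ τ ≫ (α_ X A X).inv ≫ τ ▷ X ≫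
          (α_ A X X).hom) ▷ A ⊗≫ (sA ▷ (X ⊗ X) ⊗≫ A ◁ (sX ▷ X)) ▷ A ⊗≫
          ((α_ A X X).inv ≫ s ▷ X ≫ (α_ X A X).hom ≫ X ◁ s ≫ (α_ X X A).inv ≫ μ[X] ▷ A) ▷ A ⊗≫
          X ◁ μ[A] := by monoidal
    _ = X ◁ Δ[A] ⊗≫ (τ ≫ (A ◁ Δ[X] ≫ sA ▷ (X ⊗ X)) ≫ A ◁ (sX ▷ X) ≫ A ◁ μ[X] ≫ s) ▷ A ⊗≫
          X ◁ μ[A] := by rw [← h.comul_right, ← h'.mul_right]; monoidal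
    _ = X ◁ Δ[A] ⊗≫ (τ ≫ sA ▷ X ≫ A ◁ (Δ[X] ≫ sX ▷ X ≫ μ[X]) ≫ s) ▷ A ⊗≫
          X ◁ μ[A] := by rw [whisker_exchange]; monoidal
    _ = X ◁ Δ[A] ⊗≫ (τ ≫ (sA ▷ X ≫ A ◁ ε[X]) ≫ A ◁ η[X] ≫ s) ▷ A ⊗≫
          X ◁ μ[A] := by rw [hX]; monoidal
    _ = X ◁ Δ[A] ⊗≫ ((τ ≫ A ◁ ε[X] ≫ (ρ_ A).hom) ≫ sA ≫ (λ_ A).inv ≫ η[X] ▷ A) ▷ A ⊗≫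
          X ◁ μ[A] := by rw [← whisker_exchange, h'.unit_right]; monoidal
    _ = (X ◁ Δ[A] ≫ ε[X] ▷ (A ⊗ A)) ⊗≫ sA ▷ A ⊗≫ (η[X] ▷ (A ⊗ A) ≫ X ◁ μ[A]) := by
      rw [h.counit_right]; monoidal
    _ = ε[X] ▷ A ⊗≫ (Δ[A] ≫ sA ▷ A ≫ μ[A]) ⊗≫ η[X] ▷ A := by
      rw [whisker_exchange ε[X] Δ[A], ← whisker_exchange η[X] μ[A]]; monoidal
    _ = _ := by
      rw [hA, MonoidalCategory.tensorHom_def, MonoidalCategory.tensorHom_def']; monoidal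

/-- The mirror argument: `comul_left` and `mul_left` bring the two halves of `A` together, so the
antipode of `A` cancels first and that of `X` last. -/
theorem wreath_antipode_right (hA : Δ[A] ≫ A ◁ sA ≫ μ[A] = ε[A] ≫ η[A])
    (hX : Δ[X] ≫ X ◁ sX ≫ μ[X] = ε[X] ≫ η[X]) :
    wreathComul τ ≫ (X ⊗ A) ◁ (τ ≫ (sA ⊗ₘ sX) ≫ s) ≫ wreathMul s =
      ((ε[X] ⊗ₘ ε[A]) ≫ (λ_ (𝟙_ V)).hom) ≫ (λ_ (𝟙_ V)).inv ≫ (η[X] ⊗ₘ η[A]) := by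
  rw [wreathComul, wreathMul, MonoidalCategory.tensorHom_def Δ[X],
    MonoidalCategory.tensorHom_def' μ[X], MonoidalCategory.tensorHom_def' sA]
  calc
    _ = Δ[X] ▷ A ⊗≫ X ◁ (X ◁ Δ[A] ≫ (α_ X A A).inv ≫ τ ▷ A ≫ (α_ A X A).hom ≫ A ◁ τ ≫
          (α_ A A X).inv) ⊗≫ X ◁ ((A ⊗ A) ◁ sX ⊗≫ A ◁ (sA ▷ X)) ⊗≫
          X ◁ ((α_ A A X).hom ≫ A ◁ s ≫ (α_ A X A).inv ≫ s ▷ A ≫ (α_ X A A).hom ≫ X ◁ μ[A]) ⊗≫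
          μ[X] ▷ A := by monoidal
    _ = Δ[X] ▷ A ⊗≫ X ◁ (τ ≫ (Δ[A] ▷ X ≫ (A ⊗ A) ◁ sX) ≫ (A ◁ sA) ▷ X ≫ μ[A] ▷ X ≫ s) ⊗≫
          μ[X] ▷ A := by rw [← h.comul_left, ← h'.mul_left]; monoidal
    _ = Δ[X] ▷ A ⊗≫ X ◁ (τ ≫ A ◁ sX ≫ (Δ[A] ≫ A ◁ sA ≫ μ[A]) ▷ X ≫ s) ⊗≫
          μ[X] ▷ A := by rw [← whisker_exchange]; monoidal
    _ = Δ[X] ▷ A ⊗≫ X ◁ (τ ≫ (A ◁ sX ≫ ε[A] ▷ X) ≫ η[A] ▷ X ≫ s) ⊗≫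
          μ[X] ▷ A := by rw [hA]; monoidal
    _ = Δ[X] ▷ A ⊗≫ X ◁ ((τ ≫ ε[A] ▷ X ≫ (λ_ X).hom) ≫ sX ≫ (ρ_ X).inv ≫ X ◁ η[A]) ⊗≫
          μ[X] ▷ A := by rw [whisker_exchange, h'.unit_left]; monoidal
    _ = (Δ[X] ▷ A ≫ (X ⊗ X) ◁ ε[A]) ⊗≫ X ◁ sX ⊗≫ ((X ⊗ X) ◁ η[A] ≫ μ[X] ▷ A) := by
      rw [h.counit_left]; monoidal
    _ = X ◁ ε[A] ⊗≫ (Δ[X] ≫ X ◁ sX ≫ μ[X]) ⊗≫ X ◁ η[A] := by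
      rw [← whisker_exchange Δ[X] ε[A], whisker_exchange μ[X] η[A]]; monoidal
    _ = _ := by
      rw [hX, MonoidalCategory.tensorHom_def', MonoidalCategory.tensorHom_def]; monoidal

end Antipode

end Wreath
-- Naturality moves units and products through the braiding; the unit coherences and the hexagons
-- then expand it.
theorem isMonoidDistributiveLaw_braiding {C : Type u} [Category.{v} C] [MonoidalCategory C]
    [BraidedCategory C] (A X : C) [MonObj A] [MonObj X] :
    IsMonoidDistributiveLaw A X η[X] μ[X] (β_ A X).hom where
  unit_left := by
    rw [BraidedCategory.braiding_naturality_left, braiding_tensorUnit_left, Category.assoc]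
  unit_right := by
    rw [BraidedCategory.braiding_naturality_right, braiding_tensorUnit_right, Category.assoc]
  mul_left := by
    rw [BraidedCategory.braiding_naturality_left, BraidedCategory.braiding_tensor_left_hom]
    simp only [Category.assoc]
  mul_right := by
    rw [BraidedCategory.braiding_naturality_right, BraidedCategory.braiding_tensor_right_hom]
    simp only [Category.assoc]

end SemidirectProduct

namespace LeftComod

/-! ### Monoids in comodules and their underlying monoids. -/

section Forget

variable {V : Type u} [Category.{v} V] [MonoidalCategory V] [SymmetricCategory V] {A : V}
  [BimonObj A]

/-- The monoid in `V` underlying a monoid in comodules. -/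
@[reducible]
def forgetMon (M : LeftComod A) [MonObj M] : MonObj M.X where
  one := η[M].hom
  mul := μ[M].hom
  one_mul := congrArg Hom.hom (MonObj.one_mul M)
  mul_one := congrArg Hom.hom (MonObj.mul_one M)
  mul_assoc := congrArg Hom.hom (MonObj.mul_assoc M)

/-- The comonoid in `V` underlying a comonoid in comodules. -/
@[reducible]
def forgetComon (M : LeftComod A) [ComonObj M] : ComonObj M.X where
  counit := ε[M].hom
  comul := Δ[M].hom
  counit_comul := congrArg Hom.hom (ComonObj.counit_comul M)
  comul_counit := congrArg Hom.hom (ComonObj.comul_counit M)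
  comul_assoc := congrArg Hom.hom (ComonObj.comul_assoc M)

instance : MonObj (regular A) where
  one :=
    { hom := η[A]
      comm := by
        change (η[A] ≫ (ρ_ A).inv) ≫ A ◁ η[A] = η[A] ≫ Δ[A]
        rw [Bimon.one_comul, MonoidalCategory.tensorHom_def, Category.assoc,
          rightUnitor_inv_naturality_assoc, unitors_inv_equal] }
  mul :=
    { hom := μ[A]
      comm := by
        change ((Δ[A] ⊗ₘ Δ[A]) ≫ tensorμ A A A A ≫ μ[A] ▷ (A ⊗ A)) ≫ A ◁ μ[A] = μ[A] ≫ Δ[A]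
        rw [BimonObj.mul_comul, MonoidalCategory.tensorHom_def μ[A] μ[A]]
        simp only [Category.assoc] }
  one_mul := hom_ext (MonObj.one_mul A)
  mul_one := hom_ext (MonObj.mul_one A)
  mul_assoc := hom_ext (MonObj.mul_assoc A)

instance (Y : V) [MonObj Y] : MonObj (triv A Y) where
  one :=
    { hom := η[Y]
      comm := by
        change (η[A] ≫ (ρ_ A).inv) ≫ A ◁ η[Y] = η[Y] ≫ (λ_ Y).inv ≫ η[A] ▷ Y
        rw [rightUnitor_inv_naturality, Category.assoc, ← whisker_exchange, ← unitors_inv_equal,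
          leftUnitor_inv_naturality_assoc] }
  mul :=
    { hom := μ[Y]
      comm := by
        rw [tensor_triv_coact]
        change (((λ_ Y).inv ≫ η[A] ▷ Y) ▷ Y ≫ (α_ A Y Y).hom) ≫ A ◁ μ[Y] =
          μ[Y] ≫ (λ_ Y).inv ≫ η[A] ▷ Y
        rw [leftUnitor_inv_naturality_assoc, whisker_exchange]
        monoidal }
  one_mul := hom_ext (MonObj.one_mul Y)
  mul_one := hom_ext (MonObj.mul_one Y)
  mul_assoc := hom_ext (MonObj.mul_assoc Y)

variable [BraidingCoelement A]

/-- The product on the left uses the braiding of W only to exchange the trivial factor with `M`, and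
by `braiding_triv` that is the symmetry of V. -/
theorem mul_tensor_triv (M : LeftComod A) [MonObj M] (Y : V) [MonObj Y] :
    μ[M ⊗ triv A Y].hom = tensorμ M.X Y M.X Y ≫ (μ[M].hom ⊗ₘ μ[Y]) := by
  have h : (tensorμ M (triv A Y) M (triv A Y)).hom = tensorμ M.X Y M.X Y := by
    change (α_ M.X Y (M.X ⊗ Y)).hom ≫ M.X ◁ (α_ Y M.X Y).inv ≫
      M.X ◁ (β_ (triv A Y) M).hom.hom ▷ Y ≫ M.X ◁ (α_ M.X Y Y).hom ≫
      (α_ M.X M.X (Y ⊗ Y)).inv = _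
    rw [braiding_triv]
    rfl
  rw [← h]
  rfl

/-- Once the product on the target is known to be the ordinary one, the two conditions are the
colinearity of the unit and of the product of `M`. -/
theorem isMonHom_coactHom (M : LeftComod A) [MonObj M] :
    letI := forgetMon M
    IsMonHom (coactHom M) :=
  letI := forgetMon M
  { one_hom := by
      refine hom_ext ?_
      have h := η[M].comm
      change (η[A] ≫ (ρ_ A).inv) ≫ A ◁ η[M].hom = η[M].hom ≫ M.coact at h
      change η[M].hom ≫ M.coact = (λ_ (𝟙_ V)).inv ≫ (η[A] ⊗ₘ η[M].hom)
      rw [← h, MonoidalCategory.tensorHom_def, unitors_inv_equal, Category.assoc,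
        rightUnitor_inv_naturality_assoc]
    mul_hom := by
      refine hom_ext ?_
      have h := μ[M].comm
      change ((M.coact ⊗ₘ M.coact) ≫ tensorμ A M.X A M.X ≫ μ[A] ▷ (M.X ⊗ M.X)) ≫
        A ◁ μ[M].hom = μ[M].hom ≫ M.coact at h
      have e := mul_tensor_triv (regular A) M.X
      change μ[M].hom ≫ M.coact = (M.coact ⊗ₘ M.coact) ≫ μ[regular A ⊗ triv A M.X].hom
      rw [← h, e]
      change _ = (M.coact ⊗ₘ M.coact) ≫ tensorμ A M.X A M.X ≫ (μ[A] ⊗ₘ μ[M].hom)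
      rw [MonoidalCategory.tensorHom_def μ[A], Category.assoc, Category.assoc] }

end Forget
end LeftComod

namespace SemidirectProduct

/-! ### The bimonoid structure on the semidirect product. -/

section Bimonoid

variable {V : Type u} [Category.{v} V] [MonoidalCategory V] [SymmetricCategory V] {A : V}
  [BimonObj A] [BraidingCoelement A]

open LeftComod

theorem isMonoidDistributiveLaw_braid (H : LeftComod A) [MonObj H] :
    IsMonoidDistributiveLaw A H.X η[H].hom μ[H].hom (braid H) :=
  have h := isMonoidDistributiveLaw_braiding (regular A) H
  { unit_left := congrArg Hom.hom h.unit_left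
    unit_right := congrArg Hom.hom h.unit_right
    mul_left := congrArg Hom.hom h.mul_left
    mul_right := congrArg Hom.hom h.mul_right }

variable (H : LeftComod A) [BimonObj H]

theorem mul_eq : μ[H ⊗ regular A].hom = mul H := by
  change ((α_ H.X A (H.X ⊗ A)).hom ≫ H.X ◁ (α_ A H.X A).inv ≫ H.X ◁ braid H ▷ A ≫
    H.X ◁ (α_ H.X A A).hom ≫ (α_ H.X H.X (A ⊗ A)).inv) ≫ (μ[H].hom ⊗ₘ μ[A]) = _
  simp only [mul, MonoidalCategory.whiskerLeft_comp, Category.assoc]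

/-- The comonoid structure of the semidirect product. -/
@[reducible]
def comonObj : ComonObj (H.X ⊗ A) :=
  letI := forgetComon H
  have h := isComonoidDistributiveLaw_tau H
  { counit := counit H
    comul := comul H
    counit_comul := wreathComul_counit_left h
    comul_counit := wreathComul_counit_right h
    comul_assoc := wreathComul_assoc h }

instance : IsMonHom Δ[H] where
  one_hom := BimonObj.one_comul H
  mul_hom := by rw [BimonObj.mul_comul]; rfl

instance : IsMonHom ε[H] where
  one_hom := BimonObj.one_counit H
  mul_hom := (BimonObj.mul_counit H).trans (by simp)

/-- The monoid structure of the semidirect product. -/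
@[reducible]
def monObj : MonObj (H.X ⊗ A) :=
  forgetMon (H ⊗ regular A)

/-- The morphism `coactRegular H`, as a morphism of comodules to a cofree comodule. -/
def coactRegularHom : H ⊗ regular A ⟶ regular A ⊗ triv A (H.X ⊗ A) :=
  coactHom (H ⊗ regular A)

/-- The comultiplication of the semidirect product, as a morphism of comodules. -/
def comulHom : H ⊗ regular A ⟶ (H ⊗ regular A) ⊗ triv A (H.X ⊗ A) :=
  Δ[H] ▷ regular A ≫ (α_ H H (regular A)).hom ≫ H ◁ coactRegularHom H ≫
    (α_ H (regular A) (triv A (H.X ⊗ A))).inv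

theorem comulHom_hom : (comulHom H).hom = comul H := by
  change Δ[H].hom ▷ A ≫ (α_ H.X H.X A).hom ≫ H.X ◁ coactRegular H ≫ (α_ H.X A (H.X ⊗ A)).inv = _
  rw [comul, coactRegular_eq, MonoidalCategory.tensorHom_def]
  monoidal

/-- In a braided category, whiskering preserves monoid morphisms and associators are monoid
morphisms; only Δ of `H` and the coaction carry content. -/
theorem isMonHom_comulHom :
    letI := monObj H
    IsMonHom (comulHom H) := by
  let := monObj H
  have : IsMonHom (coactRegularHom H) := isMonHom_coactHom (H ⊗ regular A)
  unfold comulHom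
  infer_instance

theorem mul_comul : μ[H ⊗ regular A].hom ≫ comul H = (comul H ⊗ₘ comul H) ≫
    tensorμ (H.X ⊗ A) (H.X ⊗ A) (H.X ⊗ A) (H.X ⊗ A) ≫
      (μ[H ⊗ regular A].hom ⊗ₘ μ[H ⊗ regular A].hom) := by
  let := monObj H
  have h := congrArg Hom.hom (isMonHom_comulHom H).mul_hom
  rw [comp_hom, comp_hom, mul_tensor_triv, tensorHom_hom, comulHom_hom] at h
  exact h

theorem one_comul : η[H ⊗ regular A].hom ≫ comul H =
    (λ_ (𝟙_ V)).inv ≫ (η[H ⊗ regular A].hom ⊗ₘ η[H ⊗ regular A].hom) := by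
  let := monObj H
  have h := congrArg Hom.hom (isMonHom_comulHom H).one_hom
  rw [comp_hom, comulHom_hom] at h
  exact h

omit [BraidingCoelement A] in
theorem mul_comp_counit {M : V} {m : M ⊗ M ⟶ M} {p : M ⟶ A} (h : m ≫ p = (p ⊗ₘ p) ≫ μ[A]) :
    m ≫ p ≫ ε[A] = (p ≫ ε[A] ⊗ₘ p ≫ ε[A]) ≫ (λ_ (𝟙_ V)).hom := by
  rw [reassoc_of% h, Bimon.mul_counit, tensorHom_comp_tensorHom_assoc]

/-- The counit factors through `A`: the map h ⊗ a ↦ ε(h)a is a monoid morphism in W, and ε of `A` is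
one in V. -/
theorem mul_counit : μ[H ⊗ regular A].hom ≫ counit H =
    (counit H ⊗ₘ counit H) ≫ (λ_ (𝟙_ V)).hom := by
  have h : μ[H ⊗ regular A].hom ≫ (ε[H].hom ▷ A ≫ (λ_ A).hom) =
      ((ε[H].hom ▷ A ≫ (λ_ A).hom) ⊗ₘ (ε[H].hom ▷ A ≫ (λ_ A).hom)) ≫ μ[A] :=
    congrArg Hom.hom
      (IsMonHom.mul_hom (f := ε[H] ▷ regular A ≫ (λ_ (regular A)).hom))
  have e : counit H = (ε[H].hom ▷ A ≫ (λ_ A).hom) ≫ ε[A] := by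
    rw [counit, MonoidalCategory.tensorHom_def, Category.assoc, Category.assoc]
    exact congrArg (fun t => ε[H].hom ▷ A ≫ t) (leftUnitor_naturality ε[A])
  rw [e]
  exact mul_comp_counit h

theorem one_counit : one H ≫ counit H = 𝟙 (𝟙_ V) := by
  have h : η[H].hom ≫ ε[H].hom = 𝟙 (𝟙_ V) := congrArg Hom.hom (BimonObj.one_counit H)
  rw [one, counit, Category.assoc, tensorHom_comp_tensorHom_assoc, h, BimonObj.one_counit]
  simp

/-- The bimonoid structure of the semidirect product. -/
@[reducible]
def bimonObj : BimonObj (H.X ⊗ A) :=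
  { monObj H, comonObj H with
    mul_comul := mul_comul H
    one_comul := one_comul H
    mul_counit :=
      letI := comonObj H
      (mul_counit H).trans (Comon.tensorObj_counit (H.X ⊗ A) (H.X ⊗ A)).symm
    one_counit := one_counit H }

end Bimonoid
-- The explicit formula for the antipode.
section Antipode

variable {V : Type u} [Category.{v} V] [MonoidalCategory V] [SymmetricCategory V]

open LeftComod

/-- Naturality of the braiding lets `g` be evaluated on either side of `B`. Symmetry of V is what
cancels the crossing of `B` with `C`. -/
theorem braiding_whiskerLeft_functional {A B C : V} (g : A ⊗ C ⟶ 𝟙_ V) :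
    (β_ A B).hom ▷ C ≫ (α_ B A C).hom ≫ B ◁ g ≫ (ρ_ B).hom =
      (α_ A B C).hom ≫ A ◁ (β_ B C).hom ≫ (α_ A C B).inv ≫ g ▷ B ≫ (λ_ B).hom := by
  have h : g ▷ B ≫ (λ_ B).hom = (β_ (A ⊗ C) B).hom ≫ B ◁ g ≫ (ρ_ B).hom := by
    rw [← BraidedCategory.braiding_naturality_left_assoc, braiding_rightUnitor]
  have e : A ◁ (β_ B C).hom ≫ A ◁ (β_ C B).hom = 𝟙 _ := by
    rw [← MonoidalCategory.whiskerLeft_comp, SymmetricCategory.symmetry, whiskerLeft_id]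
  rw [h, BraidedCategory.braiding_tensor_left_hom]
  simp only [Category.assoc, Iso.inv_hom_id_assoc, reassoc_of% e, Iso.hom_inv_id_assoc]

theorem braiding_functional_tensorμ {A B C X : V} (g : A ⊗ C ⟶ 𝟙_ V) :
    (β_ A B).hom ▷ (C ⊗ X) ≫ (α_ B A (C ⊗ X)).hom ≫
        B ◁ ((α_ A C X).inv ≫ g ▷ X ≫ (λ_ X).hom) =
      tensorμ A B C X ≫ g ▷ (B ⊗ X) ≫ (λ_ (B ⊗ X)).hom := by
  calc
    _ = (α_ (A ⊗ B) C X).inv ≫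
        ((β_ A B).hom ▷ C ≫ (α_ B A C).hom ≫ B ◁ g ≫ (ρ_ B).hom) ▷ X := by monoidal
    _ = _ := by
      rw [braiding_whiskerLeft_functional, tensorμ]
      monoidal

variable {A : V} [BimonObj A]

theorem tau_coact (H : LeftComod A) :
    (H.coact ≫ A ◁ H.coact) ▷ A ≫ (α_ A (A ⊗ H.X) A).hom ≫ A ◁ (β_ (A ⊗ H.X) A).hom ≫
        (α_ A A (A ⊗ H.X)).inv ≫ μ[A] ▷ (A ⊗ H.X) = tau H ≫ A ◁ H.coact := by
  calc
    _ = H.coact ▷ A ≫ (α_ A H.X A).hom ≫ A ◁ (H.coact ▷ A ≫ (β_ (A ⊗ H.X) A).hom) ≫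
        (α_ A A (A ⊗ H.X)).inv ≫ μ[A] ▷ (A ⊗ H.X) := by monoidal
    _ = H.coact ▷ A ≫ (α_ A H.X A).hom ≫ A ◁ (β_ H.X A).hom ≫ (α_ A A H.X).inv ≫
        (A ⊗ A) ◁ H.coact ≫ μ[A] ▷ (A ⊗ H.X) := by
      rw [BraidedCategory.braiding_naturality_left]
      monoidal
    _ = _ := by
      rw [whisker_exchange, tau]
      simp only [Category.assoc]

variable [BraidingCoelement A]

/-- Moving the swap to the end leaves the factors in the order in which `antipode` applies γ. -/
theorem braid_eq_swap (H : LeftComod A) : braid H = (Δ[A] ⊗ₘ H.coact) ≫ tensorμ A A A H.X ≫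
    ((β_ A A).hom ≫ BraidingCoelement.coelt) ▷ (A ⊗ H.X) ≫ (λ_ (A ⊗ H.X)).hom ≫
      (β_ A H.X).hom := by
  change (β_ A H.X).hom ≫ (H.coact ⊗ₘ Δ[A]) ≫ tensorμ A H.X A A ≫
    BraidingCoelement.coelt ▷ (H.X ⊗ A) ≫ (λ_ (H.X ⊗ A)).hom = _
  rw [← BraidedCategory.braiding_naturality_assoc, ← reassoc_of% tensorμ_swap A A A H.X,
    MonoidalCategory.tensorHom_def (β_ A A).hom, Category.assoc, whisker_exchange_assoc,
    leftUnitor_naturality, comp_whiskerRight_assoc]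

/-- Inside the braiding, `f` passes through the coaction by colinearity, and `hA` splits sA(h₍₋₁₎a)
into two factors in reversed order, which is why γ receives the factor with a₂. -/
theorem antipode_eq (H : LeftComod A) (f : H ⟶ H) (sA : A ⟶ A)
    (hA : sA ≫ Δ[A] = Δ[A] ≫ (β_ A A).hom ≫ (sA ⊗ₘ sA)) :
    antipode H f.hom sA = tau H ≫ (sA ⊗ₘ f.hom) ≫ braid H := by
  -- The swap coming from `hA` cancels the one written here, leaving multiplicativity of Δ.
  have hA' : (Δ[A] ⊗ₘ Δ[A]) ≫ tensorμ A A A A ≫ (μ[A] ⊗ₘ μ[A]) ≫ (sA ⊗ₘ sA) =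
      μ[A] ≫ sA ≫ Δ[A] ≫ (β_ A A).hom := by
    rw [reassoc_of% hA, BraidedCategory.braiding_naturality, SymmetricCategory.symmetry_assoc,
      BimonObj.mul_comul_assoc]
  have e : (sA ⊗ₘ f.hom) ≫ (Δ[A] ⊗ₘ H.coact) =
      A ◁ H.coact ≫ (sA ≫ Δ[A]) ▷ (A ⊗ H.X) ≫ (A ⊗ A) ◁ A ◁ f.hom := by
    rw [tensorHom_comp_tensorHom, ← f.comm, MonoidalCategory.tensorHom_def',
      MonoidalCategory.whiskerLeft_comp, Category.assoc, whisker_exchange]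
  have e2 : (A ⊗ A) ◁ A ◁ f.hom ≫ tensorμ A A A H.X = tensorμ A A A H.X ≫ (A ⊗ A) ◁ A ◁ f.hom := by
    have h := tensorμ_natural_right A A (𝟙 A) f.hom
    rwa [id_tensorHom, whiskerLeft_id, id_tensorHom] at h
  rw [braid_eq_swap, reassoc_of% e, antipode, hA', reassoc_of% e2,
    whisker_exchange_assoc ((β_ A A).hom ≫ BraidingCoelement.coelt),
    leftUnitor_naturality_assoc, ← reassoc_of% braiding_functional_tensorμ, comp_whiskerRight μ[A],
    Category.assoc, reassoc_of% tau_coact]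
  simp only [comp_whiskerRight, Category.assoc]

end Antipode

/-! ### The Hopf monoid structure and the main theorem. -/

section Hopf

variable {V : Type u} [Category.{v} V] [MonoidalCategory V] [SymmetricCategory V] {A : V}

open LeftComod

/-- The Hopf monoid structure of the semidirect product. -/
@[reducible]
def hopfObj [kA : HopfObj A] [BraidingCoelement A] (H : LeftComod A) [kH : HopfObj H] :
    HopfObj (H.X ⊗ A) :=
  letI := forgetMon H
  letI := forgetComon H
  { bimonObj H with
    antipode := antipode H kH.antipode.hom kA.antipode
    antipode_left := by
      have h := wreath_antipode_left (isComonoidDistributiveLaw_tau H)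
        (isMonoidDistributiveLaw_braid H) (HopfObj.antipode_left A)
        (congrArg Hom.hom (HopfObj.antipode_left H))
      rw [antipode_eq H kH.antipode kA.antipode (HopfObj.antipode_comul A)]
      change comul H ≫ _ ▷ (H.X ⊗ A) ≫ μ[H ⊗ regular A].hom = counit H ≫ one H
      rw [mul_eq]
      exact h
    antipode_right := by
      have h := wreath_antipode_right (isComonoidDistributiveLaw_tau H)
        (isMonoidDistributiveLaw_braid H) (HopfObj.antipode_right A)
        (congrArg Hom.hom (HopfObj.antipode_right H))
      rw [antipode_eq H kH.antipode kA.antipode (HopfObj.antipode_comul A)]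
      change comul H ≫ (H.X ⊗ A) ◁ _ ≫ μ[H ⊗ regular A].hom = counit H ≫ one H
      rw [mul_eq]
      exact h }

end Hopf
end SemidirectProduct

theorem mainTheorem1 {V : Type u} [Category.{v} V] [MonoidalCategory V] [SymmetricCategory V]
    (A : V) [bA : BimonObj A] [BraidingCoelement A] (H : LeftComod A) [bH : BimonObj H] :
    SemidirectProduct.IsComonoidDistributiveLaw A H.X ε[H].hom Δ[H].hom (SemidirectProduct.tau H) ∧
    SemidirectProduct.IsMonoidDistributiveLaw A H.X η[H].hom μ[H].hom (SemidirectProduct.braid H) ∧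
    ∃ B : BimonObj (H.X ⊗ A),
      B.comul = SemidirectProduct.comul H ∧ B.counit = SemidirectProduct.counit H ∧
      B.mul = SemidirectProduct.mul H ∧ B.one = SemidirectProduct.one H ∧
      ∀ (kA : HopfObj A) (kH : HopfObj H), kA.toBimonObj = bA → kH.toBimonObj = bH →
        ∃ K : HopfObj (H.X ⊗ A), K.toBimonObj = B ∧
          K.antipode = SemidirectProduct.antipode H kH.antipode.hom kA.antipode := by
  refine ⟨SemidirectProduct.isComonoidDistributiveLaw_tau H,
    SemidirectProduct.isMonoidDistributiveLaw_braid H, SemidirectProduct.bimonObj H, rfl, rfl,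
    SemidirectProduct.mul_eq H, rfl, ?_⟩
  -- Substitution makes the given bimonoid structures those underlying `kA` and `kH`, so that
  -- `hopfObj H` extends `bimonObj H` by definition.
  rintro kA kH rfl rfl
  exact ⟨SemidirectProduct.hopfObj H, rfl, rfl⟩
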